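/- Let $\Omega=(-1,1)$, $\partial\Omega=\{-1,1\}$ with counting measure $\sigma$, and let $\beta\colon\partial\Omega\to\mathbb R$ be arbitrary. Put $\mathcal H=L^2(\Omega)\oplus L^2(\partial\Omega)$ (real-valued functions) and $\mathcal V=\{(u,u|_{\partial\Omega}) : u\in H^1(\Omega)\}\subset\mathcal H$, and consider the formal operator $Lu=-(u'+\operatorname{sgn}(x)u)'+\operatorname{sgn}(x)u'$ with Wentzell--Robin boundary conditions, i.e. the operator $A$ on $\mathcal H$ associated with the form \[ \mathfrak a\bigl((u,u|_{\partial\Omega}),(v,v|_{\partial\Omega})\bigr)=\int_{-1}^1\bigl(u'v'+\operatorname{sgn}(x)\,u\,v'+\operatorname{sgn}(x)\,u'\,v\bigr)\,dx+\beta(-1)u(-1)v(-1)+\beta(1)u(1)v(1) \] on $\mathcal V$: one has $U\in D(A)$ and $AU=F$ if and only if $U\in\mathcal V$, $F\in\mathcal H$ and $\mathfrak a(U,V)=\langle F,V\rangle_{\mathcal H}$ for all $V\in\mathcal V$. Then $-A$ generates a $C_0$-semigroup $(T(t))_{t\ge0}$ on $\mathcal H$, and there is no $\omega\in\mathbb R$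 such that all operators $e^{-\omega t}T(t)$, $t\ge0$, are contractions on $L^\infty(\Omega)\oplus L^\infty(\partial\Omega)$, equipped with the norm $\|(f,g)\|=\max\{\|f\|_{L^\infty(\Omega)},\|g\|_{L^\infty(\partial\Omega)}\}$. In other words, the semigroup is not quasi-$L^\infty$-contractive. -/

import Mathlib

open MeasureTheory Filter Topology
open scoped NNReal ENNReal

noncomputable section

namespace WentzellRobin

/-- The open interval `Ω = (-1, 1)`. -/
def Omega : Set ℝ := Set.Ioo (-1) 1

/-- Lebesgue measure on `Ω`. -/
def lam : Measure ℝ := volume.restrict Omega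

/-- Surface measure on `∂Ω`: the zero-dimensional Hausdorff measure, i.e. counting measure. -/
def sigma : Measure ℝ := Measure.count.restrict (frontier Omega)

/-- The Hilbert space `L²(Ω) ⊕ L²(∂Ω)`. -/
abbrev H : Type := WithLp 2 (Lp ℝ 2 lam × Lp ℝ 2 sigma)

/-- `u'` is the weak derivative of `u` on `Ω`. -/
def HasWeakDeriv (u u' : Lp ℝ 2 lam) : Prop :=
  ∀ φ : ℝ → ℝ, ContDiff ℝ (⊤ : ℕ∞) φ → HasCompactSupport φ → tsupport φ ⊆ Omega →
    ∫ x, u x * deriv φ x ∂lam = - ∫ x, u' x * φ x ∂lam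

/-- `u ∈ H¹(Ω)`: both `u` and its weak derivative are in `L²(Ω)`. -/
def MemH1 (u : Lp ℝ 2 lam) : Prop := ∃ u' : Lp ℝ 2 lam, HasWeakDeriv u u'

open Classical in
/-- The weak derivative of an element of `H¹(Ω)` (it is unique; the value `0` is used
outside `H¹(Ω)`). -/
def weakDeriv (u : Lp ℝ 2 lam) : Lp ℝ 2 lam :=
  if h : MemH1 u then h.choose else 0

/-- `g` is the boundary trace of `u`: `u` has a representative that is continuous on the closure
of `Ω` and whose restriction to `∂Ω` is `g`. In one dimension every element of `H¹(Ω)` has such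
a representative. -/
def IsTrace (u : Lp ℝ 2 lam) (g : Lp ℝ 2 sigma) : Prop :=
  ∃ w : ℝ → ℝ, ContinuousOn w (closure Omega) ∧ u =ᵐ[lam] w ∧ g =ᵐ[sigma] w

/-- The form domain `𝒱 = {(u, u|_∂Ω) : u ∈ H¹(Ω)}`. -/
def formDomain : Set H := {U | MemH1 U.fst ∧ IsTrace U.fst U.snd}

/-- The form of `Lu = -(a u' + b u)' + c u' + d u` with boundary coefficient `β`, evaluated at
pairs `(u, u|_∂Ω)`, `(v, v|_∂Ω)`; it is meant for arguments in `formDomain`. -/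
def form (a b c d β : ℝ → ℝ) (U V : H) : ℝ :=
  (∫ x, a x * weakDeriv U.fst x * weakDeriv V.fst x ∂lam)
    + (∫ x, b x * U.fst x * weakDeriv V.fst x ∂lam)
    + (∫ x, c x * weakDeriv U.fst x * V.fst x ∂lam)
    + (∫ x, d x * U.fst x * V.fst x ∂lam)
    + ∫ z, β z * U.snd z * V.snd z ∂sigma

/-- The graph of the operator `A` on `H` associated with the form: `U ∈ D(A)` and `A U = F`. -/
def AssocOp (a b c d β : ℝ → ℝ) (U F : H) : Prop :=
  U ∈ formDomain ∧ ∀ V ∈ formDomain, form a b c d β U V = inner ℝ F V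

/-- Strongly continuous one-parameter semigroups of bounded operators on `H`. -/
structure IsC0Semigroup (T : ℝ≥0 → H →L[ℝ] H) : Prop where
  zero : T 0 = ContinuousLinearMap.id ℝ H
  add : ∀ s t, T (s + t) = (T s).comp (T t)
  tendsto_zero : ∀ F : H, Tendsto (fun t => T t F) (𝓝 0) (𝓝 F)

/-- The graph of the infinitesimal generator of `T`. -/
def Generator (T : ℝ≥0 → H →L[ℝ] H) (U F : H) : Prop :=
  Tendsto (fun t : ℝ≥0 => (t : ℝ)⁻¹ • (T t U - U)) (𝓝[>] 0) (𝓝 F)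

/-- `T` is the Wentzell-Robin semigroup, i.e. the `C₀`-semigroup generated by `-A`. -/
def IsWentzellRobinSemigroup (a b c d β : ℝ → ℝ) (T : ℝ≥0 → H →L[ℝ] H) : Prop :=
  IsC0Semigroup T ∧ ∀ U F : H, Generator T U F ↔ AssocOp a b c d β U (-F)

/-- The norm of `L^∞(Ω) ⊕ L^∞(∂Ω)`, with value `∞` for elements of `H` not in this space. -/
def linftyNorm (F : H) : ℝ≥0∞ := max (eLpNorm F.fst ∞ lam) (eLpNorm F.snd ∞ sigma)

/-- `e^{-ω t} T(t)` is, for every `t ≥ 0`, a contraction on `L^∞(Ω) ⊕ L^∞(∂Ω)`. -/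
def IsLinftyContractive (ω : ℝ) (T : ℝ≥0 → H →L[ℝ] H) : Prop :=
  ∀ (t : ℝ≥0) (F : H), linftyNorm F < ∞ →
    linftyNorm (Real.exp (-ω * t) • T t F) ≤ linftyNorm F

end WentzellRobin

end

/-! The failure comes from the jump of the coefficient sgn at `0`. A function in the domain must
have a continuous flux u' + sgn(x)u, so a positive u must have u' jump down by 2u(0) there: u has a
concave kink, and a steep one may sit at its maximum. Take u = 1 - 1/n + e^{-n|x|}/n, with u(0) =
max u = 1. Its flux is continuous and Au = -n e^{-n|x|} in the interior, so Au = -n at the maximum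
point of u. The boundary component of Au stays bounded in n, whatever β is.

With l = n² the interior part of (l + A)u is the constant n² - n, and its boundary part is at most
n² - n + 2 + b in absolute value, where b = |β(-1)| + |β(1)| (`assocOp_kink`,
`linftyNorm_resolvent_kink_le`). Quasi-contractivity with rate ω would force (l - ω)‖u‖ ≤ ‖(l + A)u‖
in the sup norm (`IsC0Semigroup.mul_abs_le_of_isLinftyContractive`), that is n ≤ ω + 2 + b, which is
false for large n.

Generation is the classical form method. H¹(Ω) is parametrized by the value at -1 and the
derivative, and `formDomain_eq_range` identifies the form domain with the image of this
parametrization. The image is dense (`denseRange_embed`) and the form is elliptic after adding a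
multiple of the norm of `H` (`formL_coercive`). Lax-Milgram then yields resolvents, and the Yosida
approximation turns them into a semigroup (`exists_semigroup_of_form`). -/

noncomputable section

/-! ### Hille-Yosida theorem for m-accretive operators -/

namespace HilleYosida

open scoped InnerProductSpace

variable {E : Type*} [NormedAddCommGroup E] [InnerProductSpace ℝ E]

/-- A bounded operator `P` is dissipative if `⟪P x, x⟫ ≤ 0` for all `x`. -/
def Dissipative (P : E →L[ℝ] E) : Prop := ∀ x, ⟪P x, x⟫_ℝ ≤ 0

section Exponential

variable [CompleteSpace E]

theorem hasDerivAt_exp_apply (P : E →L[ℝ] E) (x : E) (t : ℝ) :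
    HasDerivAt (fun s : ℝ => NormedSpace.exp (s • P) x) (NormedSpace.exp (t • P) (P x)) t := by
  simpa using (hasDerivAt_exp_smul_const P t).clm_apply (hasDerivAt_const t x)

/-- The derivative of the squared norm along the orbit is 2⟪y, P y⟫ ≤ 0. -/
theorem norm_exp_apply_le {P : E →L[ℝ] E} (hP : Dissipative P) {t : ℝ} (ht : 0 ≤ t) (x : E) :
    ‖NormedSpace.exp (t • P) x‖ ≤ ‖x‖ := by
  have hd : ∀ s : ℝ, HasDerivAt (fun s : ℝ => ‖NormedSpace.exp (s • P) x‖ ^ 2)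
      (2 * ⟪NormedSpace.exp (s • P) x, P (NormedSpace.exp (s • P) x)⟫_ℝ) s := by
    intro s
    have h : HasDerivAt (fun s : ℝ => NormedSpace.exp (s • P) x)
        (P (NormedSpace.exp (s • P) x)) s := by
      simpa using (hasDerivAt_exp_smul_const' P s).clm_apply (hasDerivAt_const s x)
    exact h.norm_sq
  have hanti : Antitone (fun s : ℝ => ‖NormedSpace.exp (s • P) x‖ ^ 2) := by
    refine antitone_of_deriv_nonpos (fun s => (hd s).differentiableAt) fun s => ?_
    rw [(hd s).deriv, real_inner_comm]
    linarith [hP (NormedSpace.exp (s • P) x)]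
  have h := hanti ht
  simp only [zero_smul, NormedSpace.exp_zero, one_apply_eq_self] at h
  exact (sq_le_sq₀ (norm_nonneg _) (norm_nonneg _)).1 h

/-- The path s ↦ e^{sP} e^{(t-s)Q} x joins the two points. Since P and Q commute, its velocity is
e^{sP} e^{(t-s)Q} (P x - Q x), and both exponentials are contractions. -/
theorem norm_exp_apply_sub_exp_apply_le {P Q : E →L[ℝ] E} (hP : Dissipative P)
    (hQ : Dissipative Q) (hPQ : Commute P Q) {t : ℝ} (ht : 0 ≤ t) (x : E) :
    ‖NormedSpace.exp (t • P) x - NormedSpace.exp (t • Q) x‖ ≤ t * ‖P x - Q x‖ := by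
  have hcomm : ∀ s : ℝ, Commute (NormedSpace.exp (s • Q)) P := fun s =>
    ((hPQ.symm.smul_left s).exp_left)
  have hd : ∀ s : ℝ, HasDerivAt
      (fun s : ℝ => (NormedSpace.exp (s • P) * NormedSpace.exp ((t - s) • Q)) x)
      ((NormedSpace.exp (s • P)) ((NormedSpace.exp ((t - s) • Q)) (P x - Q x))) s := by
    intro s
    have h1 := hasDerivAt_exp_smul_const P s
    have h2 : HasDerivAt (fun s : ℝ => NormedSpace.exp ((t - s) • Q))
        ((-1 : ℝ) • (NormedSpace.exp ((t - s) • Q) * Q)) s :=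
      (hasDerivAt_exp_smul_const Q (t - s)).scomp s ((hasDerivAt_id s).const_sub t)
    have h3 := (h1.mul h2).clm_apply (hasDerivAt_const s x)
    convert! h3 using 1
    have := congrArg (fun L : E →L[ℝ] E => L x) (hcomm (t - s)).eq
    simp only [mul_apply_eq_comp] at this
    simp [-map_sub]
    rw [map_sub, map_sub, this, sub_eq_add_neg]
  have := norm_image_sub_le_of_norm_deriv_le_segment' (a := 0) (b := t)
    (fun s _ => (hd s).hasDerivWithinAt) (C := ‖P x - Q x‖) (fun s hs =>
      (norm_exp_apply_le hP hs.1 _).trans (norm_exp_apply_le hQ (by linarith [hs.2]) _)) t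
    ⟨ht, le_rfl⟩
  simpa [mul_comm] using this

theorem norm_exp_apply_sub_le {P : E →L[ℝ] E} (hP : Dissipative P) {t : ℝ} (ht : 0 ≤ t)
    (x : E) : ‖NormedSpace.exp (t • P) x - x‖ ≤ t * ‖P x‖ := by
  have h0 : Dissipative (0 : E →L[ℝ] E) := fun x => by simp
  simpa using norm_exp_apply_sub_exp_apply_le hP h0 (Commute.zero_right P) ht x

theorem norm_exp_apply_sub_sub_le {P : E →L[ℝ] E} {t C : ℝ} (ht : 0 ≤ t) (x : E)
    (hC : ∀ s, 0 ≤ s → s ≤ t → ‖NormedSpace.exp (s • P) (P x) - P x‖ ≤ C) :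
    ‖NormedSpace.exp (t • P) x - x - t • P x‖ ≤ t * C := by
  have hd : ∀ s : ℝ, HasDerivAt (fun s : ℝ => NormedSpace.exp (s • P) x - s • P x)
      (NormedSpace.exp (s • P) (P x) - P x) s := fun s => by
    simpa using! (hasDerivAt_exp_apply P x s).sub ((hasDerivAt_id s).smul_const (P x))
  have := norm_image_sub_le_of_norm_deriv_le_segment' (a := 0) (b := t)
    (fun s _ => (hd s).hasDerivWithinAt) (C := C) (fun s hs => hC s hs.1 hs.2.le) t ⟨ht, le_rfl⟩
  simp only [zero_smul, NormedSpace.exp_zero, one_apply_eq_self, sub_zero] at this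
  rw [sub_right_comm, mul_comm]
  exact this

end Exponential

theorem cauchySeq_of_dense {L : ℕ → E →L[ℝ] E} (hL : ∀ n x, ‖L n x‖ ≤ ‖x‖) {s : Set E}
    (hs : Dense s) (h : ∀ y ∈ s, CauchySeq fun n => L n y) (x : E) :
    CauchySeq fun n => L n x := by
  rw [Metric.cauchySeq_iff]
  intro ε hε
  obtain ⟨y, hy, hxy⟩ := Metric.dense_iff.1 hs x (ε / 4) (by positivity)
  rw [Metric.mem_ball, dist_eq_norm] at hy
  obtain ⟨N, hN⟩ := Metric.cauchySeq_iff.1 (h y hxy) (ε / 4) (by positivity)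
  refine ⟨N, fun m hm n hn => ?_⟩
  have h1 := hN m hm n hn
  rw [dist_eq_norm] at h1 ⊢
  have h2 := hL m (y - x)
  have h3 := hL n (y - x)
  have : L m x - L n x = (L m y - L n y) - L m (y - x) + L n (y - x) := by
    simp only [map_sub]; abel
  rw [this]
  calc _ ≤ ‖L m y - L n y‖ + ‖L m (y - x)‖ + ‖L n (y - x)‖ :=
        (norm_add_le _ _).trans (add_le_add_left (norm_sub_le _ _) _)
    _ < ε := by linarith

/-- `R l` is, for every `l > 0`, the resolvent `(l + A)⁻¹` of the densely defined m-accretive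
operator with graph `A`. -/
structure IsResolvent (R : ℝ → E →L[ℝ] E) (A : E → E → Prop) : Prop where
  norm_le : ∀ l, 0 < l → ∀ x, l * ‖R l x‖ ≤ ‖x‖
  graph_iff : ∀ l, 0 < l → ∀ U F, A U F ↔ R l (l • U + F) = U
  dense : Dense {U | ∃ F, A U F}

/-- The Yosida approximation of `-A`. -/
def yosida (R : ℝ → E →L[ℝ] E) (l : ℝ) : E →L[ℝ] E := l • (l • R l - 1)

namespace IsResolvent

variable {R : ℝ → E →L[ℝ] E} {A : E → E → Prop}

theorem graph_resolvent (hR : IsResolvent R A) {l : ℝ} (hl : 0 < l) (x : E) :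
    A (R l x) (x - l • R l x) := by
  rw [hR.graph_iff l hl]
  congr 1
  abel

theorem resolvent_sub (hR : IsResolvent R A) {l m : ℝ} (hl : 0 < l) (hm : 0 < m) (x : E) :
    R m x - R l x = (l - m) • R l (R m x) := by
  have h := (hR.graph_iff l hl _ _).1 (hR.graph_resolvent hm x)
  nth_rewrite 1 [← h]
  simp only [map_add, map_sub, map_smul, sub_smul]
  abel

/-- Comparing the resolvent identities for (l, m) and (m, l) shows that (l - m) times the commutator
vanishes. -/
theorem commute_resolvent (hR : IsResolvent R A) {l m : ℝ} (hl : 0 < l) (hm : 0 < m) :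
    Commute (R l) (R m) := by
  rcases eq_or_ne l m with rfl | hlm
  · exact Commute.refl _
  ext x
  have h1 := hR.resolvent_sub hl hm x
  have h2 := hR.resolvent_sub hm hl x
  have h3 : (l - m) • (R l (R m x) - R m (R l x)) = 0 := by
    rw [smul_sub, ← h1, ← neg_sub m l, neg_smul, ← h2]
    abel
  exact sub_eq_zero.1 ((smul_eq_zero.1 h3).resolve_left (sub_ne_zero.2 hlm))

theorem dissipative_yosida (hR : IsResolvent R A) {l : ℝ} (hl : 0 < l) :
    Dissipative (yosida R l) := by
  intro x
  have h1 := real_inner_le_norm (R l x) x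
  have h2 := hR.norm_le l hl x
  simp only [yosida, smul_apply, sub_apply,
    one_apply_eq_self, inner_smul_left, inner_sub_left, conj_trivial,
    real_inner_self_eq_norm_sq]
  have h3 : l * ⟪R l x, x⟫_ℝ ≤ ‖x‖ * ‖x‖ :=
    calc l * ⟪R l x, x⟫_ℝ ≤ l * (‖R l x‖ * ‖x‖) := by gcongr
      _ = l * ‖R l x‖ * ‖x‖ := by ring
      _ ≤ ‖x‖ * ‖x‖ := by gcongr
  nlinarith

theorem commute_yosida (hR : IsResolvent R A) {l m : ℝ} (hl : 0 < l) (hm : 0 < m) :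
    Commute (yosida R l) (yosida R m) := by
  unfold yosida
  refine Commute.smul_left (Commute.smul_right ?_ _) _
  refine Commute.sub_left (Commute.sub_right ?_ (Commute.one_right _)) (Commute.one_left _)
  exact ((hR.commute_resolvent hl hm).smul_left _).smul_right _

/-- On the domain the Yosida approximation is -A followed by l R(l), which is a contraction tending
strongly to the identity; boundedness and convergence to -A both follow. -/
theorem yosida_apply (hR : IsResolvent R A) {l : ℝ} (hl : 0 < l) {U F : E} (h : A U F) :
    yosida R l U = -(l • R l F) := by
  have h1 := (hR.graph_iff l hl _ _).1 h
  rw [map_add, map_smul] at h1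
  simp only [yosida, smul_apply, sub_apply,
    one_apply_eq_self]
  rw [← smul_neg]
  congr 1
  nth_rewrite 2 [← h1]
  abel

theorem norm_yosida_apply_le (hR : IsResolvent R A) {l : ℝ} (hl : 0 < l) {U F : E} (h : A U F) :
    ‖yosida R l U‖ ≤ ‖F‖ := by
  rw [hR.yosida_apply hl h, norm_neg, norm_smul, Real.norm_of_nonneg hl.le]
  exact hR.norm_le l hl F

/-- For y in the domain with image F, l R(l) y - y = -R(l) F is O(1/l). The operators l R(l) are
contractions, so density suffices. -/
theorem tendsto_smul_resolvent (hR : IsResolvent R A) (x : E) :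
    Tendsto (fun n : ℕ => ((n : ℝ) + 1) • R ((n : ℝ) + 1) x) atTop (𝓝 x) := by
  have hpos : ∀ n : ℕ, (0 : ℝ) < n + 1 := fun n => by positivity
  rw [Metric.tendsto_atTop]
  intro ε hε
  obtain ⟨y, hy, F, hyF⟩ := Metric.dense_iff.1 hR.dense x (ε / 4) (by positivity)
  rw [Metric.mem_ball, dist_eq_norm] at hy
  obtain ⟨N, hN⟩ := exists_nat_gt (‖F‖ / (ε / 4))
  refine ⟨N, fun n hn => ?_⟩
  set l : ℝ := (n : ℝ) + 1 with hl
  have hl0 : 0 < l := hpos n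
  have h1 := (hR.graph_iff l hl0 _ _).1 hyF
  rw [map_add, map_smul] at h1
  have h2 : l • R l x - x = -(l • R l (y - x)) - R l F + (y - x) := by
    rw [← sub_eq_zero, ← sub_eq_zero.2 h1]
    simp only [map_sub, smul_sub]
    abel
  have h3 : ‖l • R l (y - x)‖ ≤ ‖y - x‖ := by
    rw [norm_smul, Real.norm_of_nonneg hl0.le]
    exact hR.norm_le l hl0 _
  have h4 : ‖R l F‖ < ε / 4 := by
    have h5 := hR.norm_le l hl0 F
    have h6 : ‖F‖ < (ε / 4) * l := by
      rw [div_lt_iff₀ (by positivity)] at hN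
      have : (N : ℝ) ≤ n := by exact_mod_cast hn
      nlinarith
    nlinarith
  rw [dist_eq_norm, h2]
  calc _ ≤ ‖l • R l (y - x)‖ + ‖R l F‖ + ‖y - x‖ := by
        refine (norm_add_le _ _).trans (add_le_add_left ((norm_sub_le _ _).trans ?_) _)
        rw [norm_neg]
    _ < ε := by linarith

theorem tendsto_yosida_apply (hR : IsResolvent R A) {U F : E} (h : A U F) :
    Tendsto (fun n : ℕ => yosida R ((n : ℝ) + 1) U) atTop (𝓝 (-F)) := by
  have h1 := (hR.tendsto_smul_resolvent F).neg
  refine h1.congr fun n => ?_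
  rw [hR.yosida_apply (by positivity) h]

theorem exists_tendsto_exp_yosida [CompleteSpace E] (hR : IsResolvent R A) {t : ℝ} (ht : 0 ≤ t) 
    (x : E) :
    ∃ y, Tendsto (fun n : ℕ => NormedSpace.exp (t • yosida R ((n : ℝ) + 1)) x) atTop (𝓝 y) := by
  have hpos : ∀ n : ℕ, (0 : ℝ) < n + 1 := fun n => by positivity
  apply cauchySeq_tendsto_of_complete
  refine cauchySeq_of_dense
    (fun n x => norm_exp_apply_le (hR.dissipative_yosida (hpos n)) ht x) hR.dense ?_ x
  rintro y ⟨F, hyF⟩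
  have hc := ((hR.tendsto_yosida_apply hyF).const_smul t).cauchySeq
  rw [Metric.cauchySeq_iff] at hc ⊢
  intro ε hε
  obtain ⟨N, hN⟩ := hc ε hε
  refine ⟨N, fun m hm n hn => lt_of_le_of_lt ?_ (hN m hm n hn)⟩
  rw [dist_eq_norm, dist_eq_norm, ← smul_sub, norm_smul, Real.norm_of_nonneg ht]
  exact norm_exp_apply_sub_exp_apply_le (hR.dissipative_yosida (hpos m))
    (hR.dissipative_yosida (hpos n)) (hR.commute_yosida (hpos m) (hpos n)) ht y

/-- **Hille-Yosida theorem** for m-accretive operators on a Hilbert space. -/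
theorem exists_semigroup [CompleteSpace E] (hR : IsResolvent R A) :
    ∃ T : ℝ≥0 → E →L[ℝ] E,
    T 0 = ContinuousLinearMap.id ℝ E ∧ (∀ s t, T (s + t) = (T s).comp (T t)) ∧
    (∀ x, Tendsto (fun t => T t x) (𝓝 0) (𝓝 x)) ∧
    ∀ U F, Tendsto (fun t : ℝ≥0 => (t : ℝ)⁻¹ • (T t U - U)) (𝓝[>] 0) (𝓝 F) ↔ A U (-F) := by
  have hpos : ∀ n : ℕ, (0 : ℝ) < n + 1 := fun n => by positivity
  choose f hf using fun t : ℝ≥0 => fun x : E => hR.exists_tendsto_exp_yosida t.2 x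
  let Y : ℕ → E →L[ℝ] E := fun n => yosida R ((n : ℝ) + 1)
  have hY : ∀ n, Dissipative (Y n) := fun n => hR.dissipative_yosida (hpos n)
  let T : ℝ≥0 → E →L[ℝ] E := fun t =>
    continuousLinearMapOfTendsto (fun n => NormedSpace.exp ((t : ℝ) • Y n))
      (tendsto_pi_nhds.2 (hf t))
  have hT : ∀ (t : ℝ≥0) x, Tendsto (fun n => NormedSpace.exp ((t : ℝ) • Y n) x) atTop (𝓝 (T t x)) :=
    fun t x => hf t x
  have hTle : ∀ t x, ‖T t x‖ ≤ ‖x‖ := fun t x =>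
    le_of_tendsto (hT t x).norm (Eventually.of_forall fun n => norm_exp_apply_le (hY n) t.2 x)
  have hTsub : ∀ (t : ℝ≥0) {U F}, A U F → ‖T t U - U‖ ≤ t * ‖F‖ := fun t U F h =>
    le_of_tendsto ((hT t U).sub_const U).norm (Eventually.of_forall fun n =>
      (norm_exp_apply_sub_le (hY n) t.2 U).trans
        (mul_le_mul_of_nonneg_left (hR.norm_yosida_apply_le (hpos n) h) t.2))
  have hgen : ∀ U F, A U (-F) →
      Tendsto (fun t : ℝ≥0 => (t : ℝ)⁻¹ • (T t U - U)) (𝓝[>] 0) (𝓝 F) := by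
    intro U F h
    -- F need not lie in the domain, so it is replaced by a nearby y that does, at the cost 2‖F -
    -- y‖. The approximating orbits of y move by at most t‖G‖, uniformly in n.
    have key : ∀ (t : ℝ≥0) {y G}, A y G →
        ‖T t U - U - (t : ℝ) • F‖ ≤ t * (2 * ‖F - y‖ + t * ‖G‖) := by
      intro t y G hy
      have hYU : Tendsto (fun n => Y n U) atTop (𝓝 F) := by
        simpa using hR.tendsto_yosida_apply h
      have hlim : Tendsto (fun n => (t : ℝ) * (2 * ‖Y n U - y‖ + t * ‖G‖)) atTop
          (𝓝 (t * (2 * ‖F - y‖ + t * ‖G‖))) :=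
        (((hYU.sub_const y).norm.const_mul 2).add_const _).const_mul _
      refine le_of_tendsto_of_tendsto (((hT t U).sub_const U).sub (hYU.const_smul (t : ℝ))).norm
        hlim (Eventually.of_forall fun n => ?_)
      refine norm_exp_apply_sub_sub_le t.2 U fun s hs hst => ?_
      have h1 : NormedSpace.exp (s • Y n) (Y n U) - Y n U
          = NormedSpace.exp (s • Y n) (Y n U - y) + (NormedSpace.exp (s • Y n) y - y)
            - (Y n U - y) := by
        simp only [map_sub]; abel
      rw [h1]
      have h2 := norm_exp_apply_le (hY n) hs (Y n U - y)
      have h3 : ‖NormedSpace.exp (s • Y n) y - y‖ ≤ (t : ℝ) * ‖G‖ :=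
        (norm_exp_apply_sub_le (hY n) hs y).trans
        (mul_le_mul hst (hR.norm_yosida_apply_le (hpos n) hy) (norm_nonneg _) t.2)
      calc _ ≤ ‖NormedSpace.exp (s • Y n) (Y n U - y)‖ + ‖NormedSpace.exp (s • Y n) y - y‖
            + ‖Y n U - y‖ :=
            (norm_sub_le _ _).trans (add_le_add_left (norm_add_le _ _) _)
        _ ≤ _ := by linarith
    rw [Metric.tendsto_nhdsWithin_nhds]
    intro ε hε
    obtain ⟨y, hy, G, hG⟩ := Metric.dense_iff.1 hR.dense F (ε / 4) (by positivity)
    rw [Metric.mem_ball, dist_comm, dist_eq_norm] at hy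
    refine ⟨ε / 4 / (‖G‖ + 1), by positivity, fun t ht htd => ?_⟩
    have ht0 : (0 : ℝ) < t := ht
    have htd' : (t : ℝ) < ε / 4 / (‖G‖ + 1) := by
      rw [NNReal.dist_eq] at htd
      simpa using htd
    rw [lt_div_iff₀ (by positivity)] at htd'
    have h1 := key t hG
    have h2 : (t : ℝ)⁻¹ • (T t U - U) - F = (t : ℝ)⁻¹ • (T t U - U - (t : ℝ) • F) := by
      rw [smul_sub _ (T t U - U), smul_smul, inv_mul_cancel₀ ht0.ne', one_smul]
    rw [dist_eq_norm, h2, norm_smul, norm_inv, Real.norm_of_nonneg ht0.le,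
      inv_mul_lt_iff₀ ht0]
    refine h1.trans_lt (mul_lt_mul_of_pos_left ?_ ht0)
    nlinarith [norm_nonneg G]
  refine ⟨T, ?_, ?_, ?_, fun U F => ⟨fun h => ?_, hgen U F⟩⟩
  · ext x
    refine tendsto_nhds_unique (hT 0 x) ?_
    simp
  · intro s t
    ext x
    refine tendsto_nhds_unique (hT (s + t) x) ?_
    let : NormedAlgebra ℚ (E →L[ℝ] E) := NormedAlgebra.restrictScalars ℚ ℝ _
    have h1 : ∀ n, NormedSpace.exp (((s + t : ℝ≥0) : ℝ) • Y n) x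
        = NormedSpace.exp ((s : ℝ) • Y n) (NormedSpace.exp ((t : ℝ) • Y n) x - T t x)
          + NormedSpace.exp ((s : ℝ) • Y n) (T t x) := by
      intro n
      rw [NNReal.coe_add, add_smul, NormedSpace.exp_add_of_commute
        (((Commute.refl (Y n)).smul_left _).smul_right _)]
      simp
    simp_rw [h1]
    have h2 : Tendsto (fun n => NormedSpace.exp ((s : ℝ) • Y n)
        (NormedSpace.exp ((t : ℝ) • Y n) x - T t x)) atTop (𝓝 0) := by
      refine squeeze_zero_norm (fun n => norm_exp_apply_le (hY n) s.2 _) ?_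
      simpa using ((hT t x).sub_const (T t x)).norm
    simpa using h2.add (hT s (T t x))
  · intro x
    rw [Metric.tendsto_nhds_nhds]
    intro ε hε
    obtain ⟨y, hy, G, hG⟩ := Metric.dense_iff.1 hR.dense x (ε / 4) (by positivity)
    rw [Metric.mem_ball, dist_eq_norm] at hy
    refine ⟨ε / 4 / (‖G‖ + 1), by positivity, fun t htd => ?_⟩
    have htd' : (t : ℝ) < ε / 4 / (‖G‖ + 1) := by
      rw [NNReal.dist_eq] at htd
      simpa using htd
    rw [lt_div_iff₀ (by positivity)] at htd'
    have h1 : T t x - x = -(T t (y - x)) + (T t y - y) + (y - x) := by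
      simp only [map_sub]; abel
    have h2 := hTle t (y - x)
    have h3 := hTsub t hG
    rw [dist_eq_norm, h1]
    calc _ ≤ ‖T t (y - x)‖ + ‖T t y - y‖ + ‖y - x‖ := by
          refine (norm_add_le _ _).trans (add_le_add_left ((norm_add_le _ _).trans ?_) _)
          rw [norm_neg]
      _ < ε := by nlinarith [t.2]
  -- Maximality: the generator already extends -A. Let V solve V + AV = U - F. Then the generator
  -- sends U - V to U - V itself, while a contraction semigroup has a dissipative generator; hence
  -- ‖U - V‖² ≤ 0.
  · have hW := hR.graph_resolvent one_pos (U - F)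
    set V := R 1 (U - F) with hV
    have hgV := hgen V (V - (U - F)) (by simpa using hW)
    have hsub := h.sub hgV
    have hz : U - V = 0 := by
      have h1 : Tendsto (fun t : ℝ≥0 => ⟪(t : ℝ)⁻¹ • (T t U - U) - (t : ℝ)⁻¹ • (T t V - V),
          U - V⟫_ℝ) (𝓝[>] 0) (𝓝 ⟪F - (V - (U - F)), U - V⟫_ℝ) :=
        hsub.inner tendsto_const_nhds
      have h2 : ⟪F - (V - (U - F)), U - V⟫_ℝ ≤ 0 := by
        refine le_of_tendsto h1 (Eventually.of_forall fun t => ?_)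
        have h3 : (t : ℝ)⁻¹ • (T t U - U) - (t : ℝ)⁻¹ • (T t V - V)
            = (t : ℝ)⁻¹ • (T t (U - V) - (U - V)) := by
          rw [← smul_sub, map_sub]; congr 1; abel
        rw [h3, inner_smul_left, inner_sub_left, real_inner_self_eq_norm_sq]
        have h4 := real_inner_le_norm (T t (U - V)) (U - V)
        have h5 := mul_le_mul_of_nonneg_right (hTle t (U - V)) (norm_nonneg (U - V))
        have h6 : (0 : ℝ) ≤ (t : ℝ)⁻¹ := inv_nonneg.2 t.2
        simp only [conj_trivial]
        nlinarith
      have h3 : F - (V - (U - F)) = U - V := by abel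
      rw [h3] at h2
      rw [real_inner_self_eq_norm_sq] at h2
      exact norm_eq_zero.1 (pow_eq_zero_iff two_ne_zero |>.1 (le_antisymm h2 (sq_nonneg _)))
    rw [sub_eq_zero] at hz
    rw [hR.graph_iff 1 one_pos]
    rw [one_smul, ← sub_eq_add_neg, ← hV, hz]

end IsResolvent

end HilleYosida

end

/-! ### From elliptic forms to semigroups -/

noncomputable section

namespace HilleYosida

open scoped InnerProductSpace

variable {E V : Type*} [NormedAddCommGroup E] [InnerProductSpace ℝ E]
  [NormedAddCommGroup V] [InnerProductSpace ℝ V]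

/-- The bilinear form `⟪J v, K w⟫` on `V`. -/
def innerForm (J K : V →L[ℝ] E) : V →L[ℝ] V →L[ℝ] ℝ :=
  LinearMap.mkContinuous₂ (LinearMap.mk₂ ℝ (fun v w => ⟪J v, K w⟫_ℝ)
    (fun _ _ _ => by rw [map_add, inner_add_left])
    (fun _ _ _ => by rw [map_smul, real_inner_smul_left, smul_eq_mul])
    (fun _ _ _ => by rw [map_add, inner_add_right])
    (fun _ _ _ => by rw [map_smul, real_inner_smul_right, smul_eq_mul])) (‖J‖ * ‖K‖)
    (fun v w => by
      refine (norm_inner_le_norm _ _).trans ?_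
      calc ‖J v‖ * ‖K w‖ ≤ (‖J‖ * ‖v‖) * (‖K‖ * ‖w‖) := by
            gcongr <;> exact ContinuousLinearMap.le_opNorm _ _
        _ = _ := by ring)

theorem innerForm_apply (J K : V →L[ℝ] E) (v w : V) : innerForm J K v w = ⟪J v, K w⟫_ℝ := rfl

/-- The resolvent is J ∘ (Lax-Milgram inverse of B + l⟪J·, J·⟫) ∘ J*. Testing its defining equation
with the solution itself gives l‖J R x‖² ≤ ⟪x, J R x⟫, hence the contraction bound. -/
theorem exists_isResolvent_of_form [CompleteSpace E] [CompleteSpace V] (J : V →L[ℝ] E)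
    (hJ : DenseRange J)
    (B : V →L[ℝ] V →L[ℝ] ℝ) {δ : ℝ} (hδ : 0 < δ) (hB : ∀ v, δ * ‖v‖ ^ 2 ≤ B v v) :
    ∃ R : ℝ → E →L[ℝ] E,
      IsResolvent R (fun U F => ∃ v, J v = U ∧ ∀ w, B v w = ⟪F, J w⟫_ℝ) := by
  have hco : ∀ l : ℝ, 0 < l → IsCoercive (B + l • innerForm J J) := by
    intro l hl
    refine ⟨δ, hδ, fun v => ?_⟩
    have h1 : 0 ≤ l * ⟪J v, J v⟫_ℝ := mul_nonneg hl.le real_inner_self_nonneg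
    have h2 := hB v
    simp only [add_apply, smul_apply, innerForm_apply, smul_eq_mul]
    nlinarith
  have hex : ∀ l : ℝ, ∃ R : E →L[ℝ] V, 0 < l →
      (∀ F w, B (R F) w + l * ⟪J (R F), J w⟫_ℝ = ⟪F, J w⟫_ℝ) ∧
      (∀ F v, (∀ w, B v w + l * ⟪J v, J w⟫_ℝ = ⟪F, J w⟫_ℝ) → v = R F) := by
    intro l
    by_cases hl : 0 < l
    · refine ⟨((hco l hl).continuousLinearEquivOfBilin.symm : V →L[ℝ] V) ∘L
        ContinuousLinearMap.adjoint J, fun _ => ⟨fun F w => ?_, fun F v hv => ?_⟩⟩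
      · have h := (hco l hl).continuousLinearEquivOfBilin_apply
          ((hco l hl).continuousLinearEquivOfBilin.symm (ContinuousLinearMap.adjoint J F)) w
        rw [ContinuousLinearEquiv.apply_symm_apply, ContinuousLinearMap.adjoint_inner_left] at h
        rw [h]
        simp [innerForm_apply]
      · have h := (hco l hl).unique_continuousLinearEquivOfBilin (v := v)
          (f := ContinuousLinearMap.adjoint J F) (fun w => by
            rw [ContinuousLinearMap.adjoint_inner_left, ← hv w]
            simp [innerForm_apply])
        simp [h]
    · exact ⟨0, fun h => absurd h hl⟩
  choose R hR using hex
  have hnorm : ∀ l, 0 < l → ∀ x, l * ‖J (R l x)‖ ≤ ‖x‖ := by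
    intro l hl x
    have h1 := (hR l hl).1 x (R l x)
    rw [real_inner_self_eq_norm_sq] at h1
    have h2 := real_inner_le_norm x (J (R l x))
    have h3 := hB (R l x)
    have h4 : 0 ≤ δ * ‖R l x‖ ^ 2 := by positivity
    rcases (norm_nonneg (J (R l x))).eq_or_lt with h0 | h0
    · rw [← h0, mul_zero]; exact norm_nonneg x
    · refine le_of_mul_le_mul_right ?_ h0
      nlinarith
  refine ⟨fun l => J ∘L R l, ⟨hnorm, fun l hl U F => ⟨?_, fun h => ?_⟩, ?_⟩⟩
  · rintro ⟨v, rfl, hv⟩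
    refine congrArg J ((hR l hl).2 _ v fun w => ?_).symm
    rw [inner_add_left, real_inner_smul_left, hv w, add_comm]
  · refine ⟨R l (l • U + F), h, fun w => ?_⟩
    have h1 := (hR l hl).1 (l • U + F) w
    have h2 : J (R l (l • U + F)) = U := h
    rw [h2, inner_add_left, real_inner_smul_left] at h1
    linarith
  -- If z is orthogonal to the range of J ∘ R 1, testing the equation of R 1 z with itself forces R
  -- 1 z = 0. The equation then says that z is orthogonal to the range of J, which is dense.
  · have hd : Dense ((J ∘L R 1).range : Set E) := by
      rw [Submodule.dense_iff_topologicalClosure_eq_top, Submodule.topologicalClosure_eq_top_iff,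
        Submodule.eq_bot_iff]
      intro z hz
      have h0 : ⟪z, J (R 1 z)⟫_ℝ = 0 := by
        rw [real_inner_comm]
        exact (Submodule.mem_orthogonal _ z).1 hz _ ⟨z, rfl⟩
      have h1 := (hR 1 one_pos).1 z (R 1 z)
      rw [h0, real_inner_self_eq_norm_sq] at h1
      have h2 : ‖R 1 z‖ ^ 2 = 0 := by
        have h3 := hB (R 1 z)
        have h4 := sq_nonneg ‖J (R 1 z)‖
        have h5 := sq_nonneg ‖R 1 z‖
        nlinarith
      have h3 : R 1 z = 0 := by simpa using h2
      refine hJ.eq_zero_of_inner_left ℝ fun w => ?_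
      have h4 := (hR 1 one_pos).1 z w
      rw [h3] at h4
      simpa using h4.symm
    refine hd.mono ?_
    rintro _ ⟨x, rfl⟩
    refine ⟨x - J (R 1 x), R 1 x, rfl, fun w => ?_⟩
    have h4 := (hR 1 one_pos).1 x w
    rw [inner_sub_left]
    linarith

/-- The operator associated with a bounded `J`-elliptic form generates a `C₀`-semigroup. -/
theorem exists_semigroup_of_form [CompleteSpace E] [CompleteSpace V] (J : V →L[ℝ] E)
    (hJ : DenseRange J)
    (B : V →L[ℝ] V →L[ℝ] ℝ) {μ δ : ℝ} (hδ : 0 < δ)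
    (hB : ∀ v, δ * ‖v‖ ^ 2 ≤ B v v + μ * ‖J v‖ ^ 2) :
    ∃ T : ℝ≥0 → E →L[ℝ] E,
      T 0 = ContinuousLinearMap.id ℝ E ∧ (∀ s t, T (s + t) = (T s).comp (T t)) ∧
      (∀ x, Tendsto (fun t => T t x) (𝓝 0) (𝓝 x)) ∧
      ∀ U F, Tendsto (fun t : ℝ≥0 => (t : ℝ)⁻¹ • (T t U - U)) (𝓝[>] 0) (𝓝 F) ↔
        ∃ v, J v = U ∧ ∀ w, B v w = ⟪-F, J w⟫_ℝ := by
  -- Adding μ⟪J·, J·⟫ makes the form coercive; the factor e^{μt} on the resulting semigroup `S`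
  -- undoes this shift.
  obtain ⟨R, hR⟩ := exists_isResolvent_of_form J hJ (B + μ • innerForm J J) hδ (fun v => by
    simpa [innerForm_apply, real_inner_self_eq_norm_sq] using hB v)
  obtain ⟨S, hS0, hSadd, hSlim, hSgen⟩ := hR.exists_semigroup
  have hexp : Tendsto (fun t : ℝ≥0 => Real.exp (μ * t)) (𝓝 0) (𝓝 1) := by
    have : Continuous fun t : ℝ≥0 => Real.exp (μ * t) := by fun_prop
    simpa using this.tendsto 0
  have hdexp : Tendsto (fun t : ℝ≥0 => (t : ℝ)⁻¹ * (Real.exp (μ * t) - 1)) (𝓝[>] 0) (𝓝 μ) := by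
    have h1 : HasDerivAt (fun t : ℝ => Real.exp (μ * t)) μ 0 := by
      simpa using ((hasDerivAt_id (0 : ℝ)).const_mul μ).exp
    have h2 := h1.tendsto_slope_zero
    have h3 : Tendsto (fun t : ℝ≥0 => (t : ℝ)) (𝓝[>] 0) (𝓝[≠] 0) := by
      refine tendsto_nhdsWithin_iff.2 ⟨?_, ?_⟩
      · exact (NNReal.continuous_coe.tendsto' 0 0 rfl).mono_left nhdsWithin_le_nhds
      · filter_upwards [self_mem_nhdsWithin] with t ht
        exact NNReal.coe_ne_zero.2 (ne_of_gt ht)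
    refine (h2.comp h3).congr fun t => ?_
    simp
  refine ⟨fun t => Real.exp (μ * t) • S t, ?_, fun s t => ?_, fun x => ?_, fun U F => ?_⟩
  · simp [hS0]
  · ext x
    simp [hSadd, mul_add, Real.exp_add, smul_smul, mul_comm (Real.exp (μ * (t : ℝ)))]
  · simpa using hexp.smul (hSlim x)
  · have h1 : Tendsto (fun t : ℝ≥0 => (t : ℝ)⁻¹ • ((Real.exp (μ * t) • S t) U - U)) (𝓝[>] 0) (𝓝 F)
        ↔ Tendsto (fun t : ℝ≥0 => (t : ℝ)⁻¹ • (S t U - U)) (𝓝[>] 0) (𝓝 (F - μ • U)) := by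
      have hid : ∀ t : ℝ≥0, (t : ℝ)⁻¹ • ((Real.exp (μ * t) • S t) U - U)
          = Real.exp (μ * t) • ((t : ℝ)⁻¹ • (S t U - U))
            + ((t : ℝ)⁻¹ * (Real.exp (μ * t) - 1)) • U := by
        intro t
        simp only [smul_apply]
        module
      have he := hexp.mono_left (nhdsWithin_le_nhds (s := Set.Ioi 0))
      constructor
      · intro h
        have h2 := (he.inv₀ one_ne_zero).smul (h.sub (hdexp.smul_const U))
        rw [inv_one, one_smul] at h2
        refine h2.congr fun t => ?_
        rw [hid t, add_sub_cancel_right, smul_smul, inv_mul_cancel₀ (Real.exp_pos _).ne', one_smul]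
      · intro h
        have h2 := (he.smul h).add (hdexp.smul_const U)
        rw [one_smul, sub_add_cancel] at h2
        exact h2.congr fun t => (hid t).symm
    rw [h1, hSgen]
    refine exists_congr fun v => and_congr_right fun hv => forall_congr' fun w => ?_
    simp only [add_apply, smul_apply, innerForm_apply, smul_eq_mul, neg_sub, inner_sub_left,
      inner_neg_left, real_inner_smul_left, hv]
    constructor <;> intro h <;> linarith

end HilleYosida

end

/-! ### The measures on Ω and ∂Ω, and a parametrization of H¹(Ω) -/

noncomputable section

namespace WentzellRobin

open scoped InnerProductSpace

theorem lam_eq : lam = volume.restrict (Set.Ioo (-1) 1) := rfl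

theorem lam_eq_Ioc : lam = volume.restrict (Set.Ioc (-1) 1) :=
  (restrict_Ioo_eq_restrict_Ioc (μ := volume) (a := (-1 : ℝ)) (b := 1))

theorem lam_restrict_Ioc {x : ℝ} (hx : x ≤ 1) :
    lam.restrict (Set.Ioc (-1) x) = volume.restrict (Set.Ioc (-1) x) := by
  rw [lam_eq_Ioc, Measure.restrict_restrict measurableSet_Ioc,
    Set.inter_eq_left.2 (Set.Ioc_subset_Ioc_right hx)]

theorem ae_lam_iff {p : ℝ → Prop} :
    (∀ᵐ x ∂lam, p x) ↔ ∀ᵐ x, x ∈ Set.Ioo (-1 : ℝ) 1 → p x :=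
  ae_restrict_iff' measurableSet_Ioo

theorem sigma_eq : sigma = Measure.dirac (-1) + Measure.dirac 1 := by
  have h : frontier Omega = {-1} ∪ {1} := by
    rw [Omega, frontier_Ioo (by norm_num)]
    rfl
  rw [sigma, h, Measure.restrict_union (by norm_num) (measurableSet_singleton _),
    Measure.restrict_singleton, Measure.restrict_singleton]
  simp

instance : IsFiniteMeasure lam := by
  rw [lam_eq]; infer_instance

instance : NullSingletonClass lam := by
  rw [lam_eq]; infer_instance

instance : IsFiniteMeasure sigma := by
  rw [sigma_eq]; infer_instance

theorem ae_sigma_iff {p : ℝ → Prop} : (∀ᵐ z ∂sigma, p z) ↔ p (-1) ∧ p 1 := by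
  rw [sigma_eq, ae_add_measure_iff, ae_dirac_eq, ae_dirac_eq, eventually_pure, eventually_pure]

theorem aestronglyMeasurable_sigma (f : ℝ → ℝ) : AEStronglyMeasurable f sigma := by
  rw [sigma_eq, aestronglyMeasurable_add_measure_iff]
  exact ⟨aestronglyMeasurable_dirac, aestronglyMeasurable_dirac⟩

theorem norm_le_of_ae_sigma (f : ℝ → ℝ) : ∀ᵐ z ∂sigma, ‖f z‖ ≤ |f (-1)| + |f 1| :=
  ae_sigma_iff.2 ⟨le_add_of_nonneg_right (abs_nonneg _), le_add_of_nonneg_left (abs_nonneg _)⟩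

theorem memLp_sigma (p : ℝ≥0∞) (f : ℝ → ℝ) : MemLp f p sigma :=
  MemLp.of_bound (aestronglyMeasurable_sigma f) _ (norm_le_of_ae_sigma f)

theorem integral_sigma (f : ℝ → ℝ) : ∫ z, f z ∂sigma = f (-1) + f 1 := by
  have h := memLp_one_iff_integrable.1 (memLp_sigma 1 f)
  rw [sigma_eq] at h ⊢
  rw [integral_add_measure h.left_of_add_measure h.right_of_add_measure, integral_dirac,
    integral_dirac]

theorem ae_lam_mem_Icc : ∀ᵐ x ∂lam, x ∈ Set.Icc (-1 : ℝ) 1 := by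
  rw [lam_eq]
  filter_upwards [ae_restrict_mem measurableSet_Ioo] with x hx using Set.Ioo_subset_Icc_self hx

theorem ae_sigma_mem_Icc : ∀ᵐ x ∂sigma, x ∈ Set.Icc (-1 : ℝ) 1 :=
  ae_sigma_iff.2 ⟨by norm_num, by norm_num⟩

theorem integral_lam (f : ℝ → ℝ) : ∫ x, f x ∂lam = ∫ x in (-1)..1, f x := by
  rw [intervalIntegral.integral_of_le (by norm_num), lam_eq_Ioc]

theorem integrable_Lp (f : Lp ℝ 2 lam) : Integrable f lam :=
  (Lp.memLp f).integrable one_le_two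

theorem intervalIntegrable_of_integrable_lam {f : ℝ → ℝ} (hf : Integrable f lam) :
    IntervalIntegrable f volume (-1) 1 := by
  rw [intervalIntegrable_iff_integrableOn_Ioc_of_le (by norm_num), IntegrableOn, ← lam_eq_Ioc]
  exact hf

/-- Parametrization of `H¹(Ω)`: the pair `(c, f)` stands for the function with derivative `f`
and value `c` at `-1`. -/
abbrev SobolevParam : Type := WithLp 2 (ℝ × Lp ℝ 2 lam)

/-- The continuous representative of the function parametrized by `v`. -/
def rep (v : SobolevParam) (x : ℝ) : ℝ := v.fst + ∫ t in (-1)..x, v.snd t ∂lam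

/-- Integration is against `lam`, so the derivative is integrable on all of ℝ and the representative
is continuous everywhere, not only on the closure of Ω. -/
theorem continuous_rep (v : SobolevParam) : Continuous (rep v) :=
  continuous_const.add (intervalIntegral.continuous_primitive
    (fun _ _ => (integrable_Lp v.snd).intervalIntegrable) _)

theorem rep_neg_one (v : SobolevParam) : rep v (-1) = v.fst := by simp [rep]

theorem rep_eq (v : SobolevParam) {x : ℝ} (hx : x ∈ Set.Icc (-1 : ℝ) 1) :
    rep v x = v.fst + ∫ t in (-1)..x, v.snd t := by
  rw [rep, intervalIntegral.integral_of_le hx.1, intervalIntegral.integral_of_le hx.1,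
    lam_restrict_Ioc hx.2]

theorem rep_add (v w : SobolevParam) (x : ℝ) : rep (v + w) x = rep v x + rep w x := by
  have h : ∫ t in (-1)..x, (v.snd + w.snd : Lp ℝ 2 lam) t ∂lam
      = ∫ t in (-1)..x, (v.snd t + w.snd t) ∂lam := by
    refine intervalIntegral.integral_congr_ae ?_
    filter_upwards [Lp.coeFn_add v.snd w.snd] with t ht _ using ht
  rw [rep, rep, rep, WithLp.add_fst, WithLp.add_snd, h, intervalIntegral.integral_add
    (integrable_Lp v.snd).intervalIntegrable (integrable_Lp w.snd).intervalIntegrable]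
  ring

theorem rep_smul (c : ℝ) (v : SobolevParam) (x : ℝ) : rep (c • v) x = c * rep v x := by
  have h : ∫ t in (-1)..x, (c • v.snd : Lp ℝ 2 lam) t ∂lam
      = ∫ t in (-1)..x, c * v.snd t ∂lam := by
    refine intervalIntegral.integral_congr_ae ?_
    filter_upwards [Lp.coeFn_smul c v.snd] with t ht _ using ht
  rw [rep, rep, WithLp.smul_fst, WithLp.smul_snd, h, intervalIntegral.integral_const_mul,
    smul_eq_mul]
  ring

/-- Cauchy-Schwarz for the derivative against the indicator of (-1, x]. This one bound yields the
embeddings into both L²(Ω) and L²(∂Ω). -/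
theorem exists_abs_rep_le :
    ∃ C : ℝ, 0 ≤ C ∧ ∀ (v : SobolevParam), ∀ x ∈ Set.Icc (-1 : ℝ) 1, |rep v x| ≤ C * ‖v‖ := by
  refine ⟨1 + lam.real Set.univ ^ (1 / (2 : ℝ≥0∞).toReal), by positivity, fun v x hx => ?_⟩
  have h1 : |∫ t in (-1)..x, v.snd t ∂lam|
      ≤ lam.real Set.univ ^ (1 / (2 : ℝ≥0∞).toReal) * ‖v.snd‖ := by
    rw [intervalIntegral.integral_of_le hx.1,
      ← L2.inner_indicatorConstLp_one measurableSet_Ioc (measure_ne_top lam _)]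
    refine (abs_real_inner_le_norm _ _).trans ?_
    rw [norm_indicatorConstLp two_ne_zero ENNReal.ofNat_ne_top, norm_one, one_mul]
    gcongr
    · exact measure_ne_top _ _
    · exact Set.subset_univ _
  have h2 : |v.fst| ≤ ‖v‖ := WithLp.norm_fst_le _ v
  have h3 : ‖v.snd‖ ≤ ‖v‖ := WithLp.norm_snd_le _ v
  calc |rep v x| ≤ |v.fst| + |∫ t in (-1)..x, v.snd t ∂lam| := abs_add_le _ _
    _ ≤ ‖v‖ + lam.real Set.univ ^ (1 / (2 : ℝ≥0∞).toReal) * ‖v‖ := by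
      refine add_le_add h2 (h1.trans ?_)
      gcongr
    _ = _ := by ring

theorem memLp_rep {μ : Measure ℝ} [IsFiniteMeasure μ] (hμ : ∀ᵐ x ∂μ, x ∈ Set.Icc (-1 : ℝ) 1)
    (p : ℝ≥0∞) (v : SobolevParam) : MemLp (rep v) p μ := by
  obtain ⟨C, -, hC⟩ := exists_abs_rep_le
  refine MemLp.of_bound (continuous_rep v).aestronglyMeasurable (C * ‖v‖) ?_
  filter_upwards [hμ] with x hx using hC v x hx

/-- The embedding of `H¹(Ω)` into `L²(μ)` for a finite measure `μ` on the closure of `Ω`. -/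
def repL2 (μ : Measure ℝ) [IsFiniteMeasure μ] (hμ : ∀ᵐ x ∂μ, x ∈ Set.Icc (-1 : ℝ) 1) :
    SobolevParam →L[ℝ] Lp ℝ 2 μ :=
  LinearMap.mkContinuousOfExistsBound
    { toFun := fun v => (memLp_rep hμ 2 v).toLp (rep v)
      map_add' := fun v w => by
        rw [← MemLp.toLp_add]
        exact MemLp.toLp_congr _ _ (Eventually.of_forall (rep_add v w))
      map_smul' := fun c v => by
        rw [RingHom.id_apply, ← MemLp.toLp_const_smul]
        exact MemLp.toLp_congr _ _ (Eventually.of_forall (rep_smul c v)) } (by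
    obtain ⟨C, hC0, hC⟩ := exists_abs_rep_le
    refine ⟨(measureUnivNNReal μ : ℝ) ^ (2 : ℝ≥0∞).toReal⁻¹ * C, fun v => ?_⟩
    rw [mul_assoc]
    refine Lp.norm_le_of_ae_bound (by positivity) ?_
    filter_upwards [hμ, (memLp_rep hμ 2 v).coeFn_toLp] with x hx hx'
    refine le_trans (le_of_eq ?_) (hC v x hx)
    exact congrArg _ hx')

theorem coeFn_repL2 {μ : Measure ℝ} [IsFiniteMeasure μ] (hμ : ∀ᵐ x ∂μ, x ∈ Set.Icc (-1 : ℝ) 1)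
    (v : SobolevParam) : repL2 μ hμ v =ᵐ[μ] rep v :=
  (memLp_rep hμ 2 v).coeFn_toLp

/-- The embedding `u ↦ (u, u|_∂Ω)` of `H¹(Ω)` into `H`. -/
def embed : SobolevParam →L[ℝ] H :=
  ((WithLp.prodContinuousLinearEquiv 2 ℝ (Lp ℝ 2 lam) (Lp ℝ 2 sigma)).symm :
      Lp ℝ 2 lam × Lp ℝ 2 sigma →L[ℝ] H) ∘L
    ((repL2 lam ae_lam_mem_Icc).prod (repL2 sigma ae_sigma_mem_Icc))

theorem embed_fst_ae (v : SobolevParam) : (embed v).fst =ᵐ[lam] rep v :=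
  coeFn_repL2 ae_lam_mem_Icc v

theorem embed_snd_ae (v : SobolevParam) : (embed v).snd =ᵐ[sigma] rep v :=
  coeFn_repL2 ae_sigma_mem_Icc v

theorem inner_sigma (f g : Lp ℝ 2 sigma) : ⟪f, g⟫_ℝ = f (-1) * g (-1) + f 1 * g 1 := by
  rw [L2.inner_def, integral_sigma]
  simp [mul_comm]

theorem inner_lam (f g : Lp ℝ 2 lam) : ⟪f, g⟫_ℝ = ∫ x, f x * g x ∂lam := by
  rw [L2.inner_def]
  simp [mul_comm]

theorem inner_H (F G : H) : ⟪F, G⟫_ℝ = (∫ x, F.fst x * G.fst x ∂lam)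
    + (F.snd (-1) * G.snd (-1) + F.snd 1 * G.snd 1) := by
  rw [WithLp.prod_inner_apply, ← inner_lam, ← inner_sigma]
  rfl

/-- Integration by parts in `H¹(Ω)`. -/
theorem integral_mul_rep_add (v w : SobolevParam) :
    ∫ x, (v.snd x * rep w x + rep v x * w.snd x) ∂lam
      = rep v 1 * rep w 1 - rep v (-1) * rep w (-1) := by
  -- Representatives are primitives of integrable functions: they are absolutely continuous, with
  -- the expected derivative almost everywhere by Lebesgue differentiation.
  have hac : ∀ v : SobolevParam, AbsolutelyContinuousOnInterval (rep v) (-1) 1 ∧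
      ∀ᵐ x, x ∈ Set.Ioo (-1 : ℝ) 1 → deriv (rep v) x = v.snd x := by
    intro v
    have hi := intervalIntegrable_of_integrable_lam (integrable_Lp v.snd)
    have hmem : (-1 : ℝ) ∈ Set.uIcc (-1 : ℝ) 1 := Set.left_mem_uIcc
    have hrep : Set.EqOn (rep v) (fun x => v.fst + ∫ t in (-1)..x, v.snd t) (Set.uIcc (-1) 1) := by
      intro x hx
      rw [Set.uIcc_of_le (by norm_num)] at hx
      exact rep_eq v hx
    constructor
    · have h1 : AbsolutelyContinuousOnInterval (fun x => v.fst + ∫ t in (-1)..x, v.snd t) (-1) 1 :=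
        (ContDiffOn.absolutelyContinuousOnInterval contDiffOn_const).add
          (hi.absolutelyContinuousOnInterval_intervalIntegral hmem)
      rw [absolutelyContinuousOnInterval_iff] at h1 ⊢
      intro ε hε
      obtain ⟨δ, hδ, h⟩ := h1 ε hε
      refine ⟨δ, hδ, fun I hI hlt => ?_⟩
      refine lt_of_le_of_lt (le_of_eq ?_) (h I hI hlt)
      refine Finset.sum_congr rfl fun i hi => ?_
      have hI' := hI.1 i hi
      rw [hrep hI'.1, hrep hI'.2]
    · filter_upwards [hi.ae_hasDerivAt_integral] with x hx hmemx
      have hx' : x ∈ Set.uIcc (-1 : ℝ) 1 := by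
        rw [Set.uIcc_of_le (by norm_num)]
        exact Set.Ioo_subset_Icc_self hmemx
      have h2 := ((hx hx' (-1) hmem).const_add v.fst)
      refine (h2.congr_of_eventuallyEq ?_).deriv
      filter_upwards [isOpen_Ioo.mem_nhds hmemx] with y hy
      exact rep_eq v (Set.Ioo_subset_Icc_self hy)
  rw [← (hac v).1.integral_deriv_mul_eq_sub (hac w).1, ← integral_lam]
  refine integral_congr_ae ?_
  filter_upwards [ae_lam_iff.2 (hac v).2, ae_lam_iff.2 (hac w).2] with x h1 h2
  rw [h1, h2]

/-- The element of `H¹(Ω)` given by a function `g` with derivative `g'`. -/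
def ofDeriv (g : ℝ → ℝ) {g' : ℝ → ℝ} (hg' : MemLp g' 2 lam) : SobolevParam :=
  WithLp.toLp 2 (g (-1), hg'.toLp g')

theorem ofDeriv_snd_ae (g : ℝ → ℝ) {g' : ℝ → ℝ} (hg' : MemLp g' 2 lam) :
    (ofDeriv g hg').snd =ᵐ[lam] g' :=
  hg'.coeFn_toLp

/-- The point 0 is exempt because the functions to which this is applied may have a kink where sgn
jumps. By continuity of g a countable exceptional set does no harm. -/
theorem rep_ofDeriv {g g' : ℝ → ℝ} (hg' : MemLp g' 2 lam) (hg : Continuous g)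
    (hd : ∀ x, x ≠ 0 → HasDerivAt g (g' x) x) {x : ℝ} (hx : x ∈ Set.Icc (-1 : ℝ) 1) :
    rep (ofDeriv g hg') x = g x := by
  have hi := intervalIntegrable_of_integrable_lam (hg'.integrable one_le_two)
  have h1 : ∫ t in (-1)..x, (ofDeriv g hg').snd t = ∫ t in (-1)..x, g' t := by
    refine intervalIntegral.integral_congr_ae_restrict ?_
    rw [Set.uIoc_of_le hx.1, ← lam_restrict_Ioc hx.2]
    exact ae_restrict_of_ae (ofDeriv_snd_ae g hg')
  rw [rep_eq _ hx, h1, integral_eq_of_hasDerivAt_off_countable g g' (Set.countable_singleton 0)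
    hg.continuousOn (fun y hy => hd y hy.2) (hi.mono_set ?_)]
  · simp [ofDeriv]
  · rw [Set.uIcc_of_le hx.1, Set.uIcc_of_le (by norm_num)]
    exact Set.Icc_subset_Icc_right hx.2

theorem memLp_lam_of_continuous {g : ℝ → ℝ} (hg : Continuous g) (p : ℝ≥0∞) : MemLp g p lam := by
  obtain ⟨C, hC⟩ := (isCompact_Icc (a := (-1 : ℝ)) (b := 1)).exists_bound_of_continuousOn
    hg.continuousOn
  refine MemLp.of_bound hg.aestronglyMeasurable C ?_
  filter_upwards [ae_lam_mem_Icc] with x hx using hC x hx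

end WentzellRobin

end

/-! ### Weak derivatives, the form domain and its density -/

noncomputable section

namespace WentzellRobin

open scoped InnerProductSpace

theorem eq_zero_of_tsupport_subset {φ : ℝ → ℝ} (hφ : tsupport φ ⊆ Omega) {x : ℝ}
    (hx : x ∉ Set.Ioo (-1 : ℝ) 1) : φ x = 0 :=
  image_eq_zero_of_notMem_tsupport fun h => hx (hφ h)

theorem integrable_mul_of_continuous {f g : ℝ → ℝ} (hf : Integrable f lam) (hg : Continuous g) :
    Integrable (fun x => f x * g x) lam := by
  obtain ⟨C, hC⟩ := (isCompact_Icc (a := (-1 : ℝ)) (b := 1)).exists_bound_of_continuousOn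
    hg.continuousOn
  refine hf.mul_bdd hg.aestronglyMeasurable (c := C) ?_
  filter_upwards [ae_lam_mem_Icc] with x hx using hC x hx

/-- Fundamental lemma of the calculus of variations on `Ω`. -/
theorem ae_eq_zero_of_integral_test {f : ℝ → ℝ} (hf : Integrable f lam)
    (h : ∀ φ : ℝ → ℝ, ContDiff ℝ (⊤ : ℕ∞) φ → HasCompactSupport φ → tsupport φ ⊆ Omega →
      ∫ x, f x * φ x ∂lam = 0) : f =ᵐ[lam] 0 := by
  refine ae_lam_iff.2 (isOpen_Ioo.ae_eq_zero_of_integral_contDiff_smul_eq_zero ?_ ?_)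
  · exact IntegrableOn.locallyIntegrableOn hf
  · intro φ h1 h2 h3
    rw [← h φ h1 h2 h3, lam_eq, setIntegral_eq_integral_of_forall_compl_eq_zero]
    · simp [mul_comm]
    · intro x hx
      rw [eq_zero_of_tsupport_subset h3 hx, mul_zero]

/-- A compactly supported smooth function on `Ω` with integral zero has a compactly supported
smooth primitive. -/
theorem exists_primitive_test {θ : ℝ → ℝ} (h1 : ContDiff ℝ (⊤ : ℕ∞) θ)
    (h2 : HasCompactSupport θ) (h3 : tsupport θ ⊆ Omega) (h0 : ∫ x, θ x ∂lam = 0) :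
    ∃ φ : ℝ → ℝ, ContDiff ℝ (⊤ : ℕ∞) φ ∧ HasCompactSupport φ ∧ tsupport φ ⊆ Omega ∧
      deriv φ = θ := by
  have hd : ∀ x, HasDerivAt (fun x => ∫ t in (-1)..x, θ t) (θ x) x := fun x =>
    (h1.continuous.integral_hasStrictDerivAt _ _).hasDerivAt
  have hderiv : deriv (fun x => ∫ t in (-1)..x, θ t) = θ := funext fun x => (hd x).deriv
  -- The support keeps a positive distance from ±1. The primitive vanishes outside [-r, r]: to the
  -- left because it starts at -1, to the right because θ has integral zero.
  obtain ⟨r, hr1, hr⟩ : ∃ r < 1, ∀ x ∈ tsupport θ, |x| ≤ r := by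
    rcases (tsupport θ).eq_empty_or_nonempty with he | hne
    · exact ⟨0, by norm_num, by simp [he]⟩
    · obtain ⟨m, hm, hmax⟩ := h2.isCompact.exists_isMaxOn hne continuous_abs.continuousOn
      exact ⟨|m|, abs_lt.2 (h3 hm), fun x hx => hmax hx⟩
  have hz : ∀ x, r < |x| → θ x = 0 := fun x hx =>
    image_eq_zero_of_notMem_tsupport fun h => (hr x h).not_gt hx
  have hzero : ∀ x, x ∉ Set.Icc (-r) r → ∫ t in (-1)..x, θ t = 0 := by
    intro x hx
    rw [Set.mem_Icc, ← abs_le, not_le] at hx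
    rcases lt_abs.1 hx with hx | hx
    · rw [integral_lam] at h0
      have hi : ∀ a b, IntervalIntegrable θ volume a b := fun a b =>
        h1.continuous.intervalIntegrable a b
      rw [← intervalIntegral.integral_add_adjacent_intervals (hi (-1) 1) (hi 1 x), h0, zero_add]
      refine (intervalIntegral.integral_congr (g := fun _ => 0) fun t ht => ?_).trans (by simp)
      refine hz t ?_
      have := (Set.mem_uIcc.1 ht)
      rw [lt_abs]
      left
      rcases this with h | h <;> linarith [h.1]
    · refine (intervalIntegral.integral_congr (g := fun _ => 0) fun t ht => ?_).trans (by simp)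
      refine hz t ?_
      have := (Set.mem_uIcc.1 ht)
      rw [lt_abs]
      right
      rcases this with h | h <;> linarith [h.2]
  have hsub : tsupport (fun x => ∫ t in (-1)..x, θ t) ⊆ Set.Icc (-r) r := by
    refine closure_minimal (fun x hx => ?_) isClosed_Icc
    by_contra hc
    exact hx (hzero x hc)
  refine ⟨_, ?_, HasCompactSupport.intro isCompact_Icc hzero, hsub.trans ?_, hderiv⟩
  · rw [contDiff_infty_iff_deriv, hderiv]
    exact ⟨fun x => (hd x).differentiableAt, h1⟩
  · exact fun x hx => ⟨by linarith [hx.1], by linarith [hx.2]⟩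

/-- A function with vanishing weak derivative is constant (lemma of du Bois-Reymond). -/
theorem ae_eq_const_of_integral_deriv_test {f : ℝ → ℝ} (hf : Integrable f lam)
    (h : ∀ φ : ℝ → ℝ, ContDiff ℝ (⊤ : ℕ∞) φ → HasCompactSupport φ → tsupport φ ⊆ Omega →
      ∫ x, f x * deriv φ x ∂lam = 0) : ∃ c : ℝ, f =ᵐ[lam] fun _ => c := by
  let b : ContDiffBump (0 : ℝ) := ⟨1 / 4, 1 / 2, by norm_num, by norm_num⟩
  let ρ : ℝ → ℝ := b.normed volume
  have hρ1 : ContDiff ℝ (⊤ : ℕ∞) ρ := b.contDiff_normed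
  have hρ2 : HasCompactSupport ρ := b.hasCompactSupport_normed
  have hρ3 : tsupport ρ ⊆ Omega := by
    have : tsupport ρ = Metric.closedBall 0 (1 / 2) := b.tsupport_normed_eq
    rw [this, Real.closedBall_eq_Icc]
    exact fun x hx => ⟨by linarith [hx.1], by linarith [hx.2]⟩
  have hρ4 : ∫ x, ρ x ∂lam = 1 := by
    rw [lam_eq, setIntegral_eq_integral_of_forall_compl_eq_zero]
    · exact b.integral_normed
    · exact fun x hx => eq_zero_of_tsupport_subset hρ3 hx
  set c := ∫ x, f x * ρ x ∂lam with hc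
  refine ⟨c, ?_⟩
  have key : (fun x => f x - c) =ᵐ[lam] 0 := by
    refine ae_eq_zero_of_integral_test (hf.sub (integrable_const c)) fun ψ h1 h2 h3 => ?_
    -- Since ρ has integral one, ψ - aρ has integral zero and is the derivative of a test function.
    -- The hypothesis then gives ∫ f ψ = a c.
    set a := ∫ x, ψ x ∂lam with ha
    have hψi : Integrable ψ lam :=
      memLp_one_iff_integrable.1 (memLp_lam_of_continuous h1.continuous 1)
    have hρi : Integrable ρ lam :=
      memLp_one_iff_integrable.1 (memLp_lam_of_continuous hρ1.continuous 1)
    have hθ1 : ContDiff ℝ (⊤ : ℕ∞) (fun x => ψ x - a * ρ x) := h1.sub (contDiff_const.mul hρ1)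
    have hsupp : tsupport (fun x => ψ x - a * ρ x) ⊆ tsupport ψ ∪ tsupport ρ := by
      refine closure_minimal (fun x hx => ?_)
        ((isClosed_tsupport _).union (isClosed_tsupport _))
      by_contra hcon
      rw [Set.mem_union, not_or] at hcon
      apply hx
      simp [image_eq_zero_of_notMem_tsupport hcon.1, image_eq_zero_of_notMem_tsupport hcon.2]
    have hθ2 : HasCompactSupport (fun x => ψ x - a * ρ x) :=
      (h2.isCompact.union hρ2.isCompact).of_isClosed_subset (isClosed_tsupport _) hsupp
    have hθ3 : tsupport (fun x => ψ x - a * ρ x) ⊆ Omega :=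
      hsupp.trans (Set.union_subset h3 hρ3)
    have hθ0 : ∫ x, (ψ x - a * ρ x) ∂lam = 0 := by
      rw [integral_sub hψi (hρi.const_mul a), integral_const_mul, hρ4, ← ha]
      ring
    obtain ⟨φ, g1, g2, g3, g4⟩ := exists_primitive_test hθ1 hθ2 hθ3 hθ0
    have h4 := h φ g1 g2 g3
    rw [g4] at h4
    have i1 := integrable_mul_of_continuous hf h1.continuous
    have i2 := integrable_mul_of_continuous hf hρ1.continuous
    have h5 : ∫ x, f x * (ψ x - a * ρ x) ∂lam = ∫ x, f x * ψ x ∂lam - a * c := by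
      rw [hc, ← integral_const_mul, ← integral_sub i1 (i2.const_mul a)]
      congr 1
      ext x
      ring
    have h6 : ∫ x, (f x - c) * ψ x ∂lam = ∫ x, f x * ψ x ∂lam - c * a := by
      rw [ha, ← integral_const_mul, ← integral_sub i1 (hψi.const_mul c)]
      congr 1
      ext x
      ring
    rw [h6]
    rw [h5] at h4
    linarith
  filter_upwards [key] with x hx
  exact sub_eq_zero.1 hx

/-- This is what makes the choice in `weakDeriv` harmless. -/
theorem hasWeakDeriv_unique {u f g : Lp ℝ 2 lam} (hf : HasWeakDeriv u f)
    (hg : HasWeakDeriv u g) : f = g := by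
  have h : (fun x => f x - g x) =ᵐ[lam] 0 := by
    refine ae_eq_zero_of_integral_test ((integrable_Lp f).sub (integrable_Lp g))
      fun φ h1 h2 h3 => ?_
    have h4 := hf φ h1 h2 h3
    rw [hg φ h1 h2 h3] at h4
    simp_rw [sub_mul]
    rw [integral_sub (integrable_mul_of_continuous (integrable_Lp f) h1.continuous)
      (integrable_mul_of_continuous (integrable_Lp g) h1.continuous)]
    linarith
  refine Lp.ext ?_
  filter_upwards [h] with x hx using sub_eq_zero.1 hx

theorem weakDeriv_eq {u f : Lp ℝ 2 lam} (h : HasWeakDeriv u f) : weakDeriv u = f := by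
  have hm : MemH1 u := ⟨f, h⟩
  rw [weakDeriv, dif_pos hm]
  exact hasWeakDeriv_unique hm.choose_spec h

theorem integral_mul_rep (v w : SobolevParam) :
    ∫ x, rep v x * w.snd x ∂lam
      = rep v 1 * rep w 1 - rep v (-1) * rep w (-1) - ∫ x, v.snd x * rep w x ∂lam := by
  have i1 := integrable_mul_of_continuous (integrable_Lp v.snd) (continuous_rep w)
  have i2 := integrable_mul_of_continuous (integrable_Lp w.snd) (continuous_rep v)
  simp_rw [mul_comm (w.snd _)] at i2
  rw [← integral_mul_rep_add v w, integral_add i1 i2]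
  ring

/-- A test function is itself a parametrized H¹ function vanishing at ±1, so integration by parts
leaves no boundary term. -/
theorem hasWeakDeriv_embed (v : SobolevParam) : HasWeakDeriv (embed v).fst v.snd := by
  intro φ h1 h2 h3
  have hφ' : MemLp (deriv φ) 2 lam := memLp_lam_of_continuous (h1.continuous_deriv (by simp)) 2
  have hrep : ∀ x ∈ Set.Icc (-1 : ℝ) 1, rep (ofDeriv φ hφ') x = φ x := fun x hx =>
    rep_ofDeriv hφ' h1.continuous
      (fun y _ => (h1.differentiable (by simp) y).hasDerivAt) hx
  have h := integral_mul_rep v (ofDeriv φ hφ')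
  rw [hrep 1 (by norm_num), hrep (-1) (by norm_num),
    eq_zero_of_tsupport_subset h3 (x := 1) (by norm_num),
    eq_zero_of_tsupport_subset h3 (x := -1) (by norm_num), mul_zero, mul_zero, sub_zero,
    zero_sub] at h
  have e1 : ∫ x, (embed v).fst x * deriv φ x ∂lam
      = ∫ x, rep v x * (ofDeriv φ hφ').snd x ∂lam := by
    refine integral_congr_ae ?_
    filter_upwards [embed_fst_ae v, ofDeriv_snd_ae φ hφ'] with x hx hx'
    rw [hx, hx']
  have e2 : ∫ x, v.snd x * φ x ∂lam = ∫ x, v.snd x * rep (ofDeriv φ hφ') x ∂lam := by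
    refine integral_congr_ae ?_
    filter_upwards [ae_lam_mem_Icc] with x hx
    rw [hrep x hx]
  rw [e1, e2, h]

theorem weakDeriv_embed (v : SobolevParam) : weakDeriv (embed v).fst = v.snd :=
  weakDeriv_eq (hasWeakDeriv_embed v)

theorem closure_Omega : closure Omega = Set.Icc (-1 : ℝ) 1 := closure_Ioo (by norm_num)

/-- U and the primitive of its weak derivative differ by a function with zero weak derivative, hence
by a constant. The continuous function defining the trace agrees a.e. with the resulting
representative, hence everywhere on [-1, 1], endpoints included. -/
theorem formDomain_eq_range : formDomain = Set.range embed := by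
  ext U
  constructor
  · rintro ⟨⟨f, hf⟩, w, hw, hUw, hUw'⟩
    let v₀ : SobolevParam := WithLp.toLp 2 (0, f)
    have hi := (integrable_Lp U.fst).sub (integrable_Lp (embed v₀).fst)
    obtain ⟨c, hc⟩ := ae_eq_const_of_integral_deriv_test hi fun φ h1 h2 h3 => by
      have e1 := hf φ h1 h2 h3
      have e2 := hasWeakDeriv_embed v₀ φ h1 h2 h3
      have hcont : Continuous (deriv φ) := h1.continuous_deriv (by simp)
      simp only [Pi.sub_apply, sub_mul]
      rw [integral_sub (integrable_mul_of_continuous (integrable_Lp _) hcont)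
        (integrable_mul_of_continuous (integrable_Lp _) hcont), e1, e2]
      exact sub_self _
    let v : SobolevParam := WithLp.toLp 2 (c, f)
    have hv : ∀ x, rep v x = rep v₀ x + c := fun x => by
      simp only [rep, v, v₀, WithLp.toLp_fst, WithLp.toLp_snd]
      ring
    have hae : U.fst =ᵐ[lam] rep v := by
      filter_upwards [hc, embed_fst_ae v₀] with x hx hx'
      rw [hv, ← hx', ← hx, Pi.sub_apply]
      ring
    have hwv : Set.EqOn w (rep v) (Set.Icc (-1) 1) := by
      refine Measure.eqOn_Icc_of_ae_eq volume (by norm_num) ?_ (closure_Omega ▸ hw)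
        (continuous_rep v).continuousOn
      rw [← restrict_Ioo_eq_restrict_Icc, ← lam_eq]
      exact hUw.symm.trans hae
    refine ⟨v, ?_⟩
    have h1 : (embed v).fst = U.fst := Lp.ext ((embed_fst_ae v).trans hae.symm)
    have h2 : (embed v).snd = U.snd := by
      refine Lp.ext ((embed_snd_ae v).trans ?_)
      filter_upwards [hUw', ae_sigma_mem_Icc] with z hz hz'
      rw [hz, hwv hz']
    exact WithLp.ofLp_injective 2 (Prod.ext h1 h2)
  · rintro ⟨v, rfl⟩
    exact ⟨⟨v.snd, hasWeakDeriv_embed v⟩, rep v, (continuous_rep v).continuousOn,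
      embed_fst_ae v, embed_snd_ae v⟩

theorem inner_embed (F : H) (v : SobolevParam) : ⟪F, embed v⟫_ℝ
    = (∫ x, F.fst x * rep v x ∂lam) + (F.snd (-1) * rep v (-1) + F.snd 1 * rep v 1) := by
  have h := ae_sigma_iff.1 (embed_snd_ae v)
  rw [inner_H, h.1, h.2]
  congr 1
  refine integral_congr_ae ?_
  filter_upwards [embed_fst_ae v] with x hx
  rw [hx]

theorem inner_embed_ofDeriv (F : H) {g g' : ℝ → ℝ} (hg' : MemLp g' 2 lam) (hg : Continuous g)
    (hd : ∀ x, x ≠ 0 → HasDerivAt g (g' x) x) : ⟪F, embed (ofDeriv g hg')⟫_ℝ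
    = (∫ x, F.fst x * g x ∂lam) + (F.snd (-1) * g (-1) + F.snd 1 * g 1) := by
  have hrep : ∀ x ∈ Set.Icc (-1 : ℝ) 1, rep (ofDeriv g hg') x = g x := fun x hx =>
    rep_ofDeriv hg' hg hd hx
  rw [inner_embed, hrep 1 (by norm_num), hrep (-1) (by norm_num)]
  congr 1
  refine integral_congr_ae ?_
  filter_upwards [ae_lam_mem_Icc] with x hx
  rw [hrep x hx]

/-- Let F be orthogonal to the range. Test functions see only the interior component and force it to
vanish; 1 + x and 1 - x then isolate the two boundary values. -/
theorem denseRange_embed : DenseRange embed := by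
  have hd : Dense (embed.range : Set H) := by
    rw [Submodule.dense_iff_topologicalClosure_eq_top, Submodule.topologicalClosure_eq_top_iff,
      Submodule.eq_bot_iff]
    intro F hF
    have h0 : ∀ v, ⟪F, embed v⟫_ℝ = 0 := fun v => by
      rw [real_inner_comm]
      exact (Submodule.mem_orthogonal _ F).1 hF _ ⟨v, rfl⟩
    have hC1 : ∀ g : ℝ → ℝ, ContDiff ℝ 1 g →
        (∫ x, F.fst x * g x ∂lam) + (F.snd (-1) * g (-1) + F.snd 1 * g 1) = 0 := by
      intro g hg
      rw [← inner_embed_ofDeriv F (memLp_lam_of_continuous (hg.continuous_deriv le_rfl) 2)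
        hg.continuous (fun x _ => (hg.differentiable one_ne_zero x).hasDerivAt)]
      exact h0 _
    have h1 : F.fst =ᵐ[lam] 0 := by
      refine ae_eq_zero_of_integral_test (integrable_Lp _) fun φ g1 g2 g3 => ?_
      have h := hC1 φ (g1.of_le (by simp))
      rwa [eq_zero_of_tsupport_subset g3 (x := 1) (by norm_num),
        eq_zero_of_tsupport_subset g3 (x := -1) (by norm_num), mul_zero, mul_zero, add_zero,
        add_zero] at h
    have h2 : ∀ g : ℝ → ℝ, ∫ x, F.fst x * g x ∂lam = 0 := fun g => by
      refine integral_eq_zero_of_ae ?_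
      filter_upwards [h1] with x hx
      simp [hx]
    have h3 := hC1 (fun x => 1 + x) (by fun_prop)
    have h4 := hC1 (fun x => 1 - x) (by fun_prop)
    rw [h2] at h3 h4
    have e1 : F.fst = 0 := Lp.ext (h1.trans (Lp.coeFn_zero _ _ _).symm)
    have e2 : F.snd = 0 := by
      refine Lp.ext (EventuallyEq.trans ?_ (Lp.coeFn_zero _ _ _).symm)
      refine ae_sigma_iff.2 ⟨?_, ?_⟩
      · show F.snd (-1) = 0
        linarith
      · show F.snd 1 = 0
        linarith
    exact WithLp.ofLp_injective 2 (Prod.ext e1 e2)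
  exact hd

end WentzellRobin

end

/-! ### Ellipticity of the form and existence of the semigroup -/

noncomputable section

namespace WentzellRobin

open scoped InnerProductSpace
open HilleYosida

/-- Multiplication by an essentially bounded function on `L²(μ)`. -/
def mulL2 {μ : Measure ℝ} {m : ℝ → ℝ} (hm : MemLp m ∞ μ) : Lp ℝ 2 μ →L[ℝ] Lp ℝ 2 μ :=
  (ContinuousLinearMap.mul ℝ ℝ).holderL μ ∞ 2 2 (hm.toLp m)

theorem coeFn_mulL2 {μ : Measure ℝ} {m : ℝ → ℝ} (hm : MemLp m ∞ μ) (f : Lp ℝ 2 μ) :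
    mulL2 hm f =ᵐ[μ] fun x => m x * f x := by
  filter_upwards [(ContinuousLinearMap.mul ℝ ℝ).coeFn_holder (r := 2) (hm.toLp m) f,
    hm.coeFn_toLp] with x h1 h2
  rw [mulL2, ContinuousLinearMap.holderL_apply_apply, h1, h2]
  rfl

theorem measurable_sign : Measurable Real.sign := by
  refine Measurable.ite measurableSet_Iio measurable_const ?_
  exact Measurable.ite measurableSet_Ioi measurable_const measurable_const

theorem abs_sign_le (x : ℝ) : |Real.sign x| ≤ 1 := by
  rcases Real.sign_apply_eq x with h | h | h <;> rw [h] <;> norm_num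

theorem memLp_sign : MemLp Real.sign ∞ lam :=
  MemLp.of_bound measurable_sign.aestronglyMeasurable 1 (Eventually.of_forall abs_sign_le)

theorem norm_mulL2_sign_le (f : Lp ℝ 2 lam) : ‖mulL2 memLp_sign f‖ ≤ ‖f‖ := by
  refine Lp.norm_le_norm_of_ae_le ?_
  filter_upwards [coeFn_mulL2 memLp_sign f] with x hx
  rw [hx, norm_mul]
  exact mul_le_of_le_one_left (norm_nonneg _) (abs_sign_le x)

/-- The form, expressed through the parametrization of `H¹(Ω)`. -/
def formL (β : ℝ → ℝ) : SobolevParam →L[ℝ] SobolevParam →L[ℝ] ℝ :=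
  innerForm (WithLp.sndL 2 ℝ ℝ (Lp ℝ 2 lam)) (WithLp.sndL 2 ℝ ℝ (Lp ℝ 2 lam))
    + innerForm (mulL2 memLp_sign ∘L repL2 lam ae_lam_mem_Icc) (WithLp.sndL 2 ℝ ℝ (Lp ℝ 2 lam))
    + innerForm (mulL2 memLp_sign ∘L WithLp.sndL 2 ℝ ℝ (Lp ℝ 2 lam)) (repL2 lam ae_lam_mem_Icc)
    + innerForm (mulL2 (memLp_sigma ∞ β) ∘L repL2 sigma ae_sigma_mem_Icc)
        (repL2 sigma ae_sigma_mem_Icc)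

theorem formL_apply (β : ℝ → ℝ) (v w : SobolevParam) : formL β v w =
    ⟪v.snd, w.snd⟫_ℝ + ⟪mulL2 memLp_sign (embed v).fst, w.snd⟫_ℝ
      + ⟪mulL2 memLp_sign v.snd, (embed w).fst⟫_ℝ
      + ⟪mulL2 (memLp_sigma ∞ β) (embed v).snd, (embed w).snd⟫_ℝ := rfl

theorem form_embed (β : ℝ → ℝ) (v w : SobolevParam) :
    form (fun _ => 1) Real.sign Real.sign (fun _ => 0) β (embed v) (embed w) = formL β v w := by
  have h1 : ∀ f g : Lp ℝ 2 lam,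
      ∫ x, Real.sign x * f x * g x ∂lam = ⟪mulL2 memLp_sign f, g⟫_ℝ := by
    intro f g
    rw [inner_lam]
    refine integral_congr_ae ?_
    filter_upwards [coeFn_mulL2 memLp_sign f] with x hx
    rw [hx]
  have h2 : ∀ f g : Lp ℝ 2 sigma,
      ∫ z, β z * f z * g z ∂sigma = ⟪mulL2 (memLp_sigma ∞ β) f, g⟫_ℝ := by
    intro f g
    have h := ae_sigma_iff.1 (coeFn_mulL2 (memLp_sigma ∞ β) f)
    rw [inner_sigma, integral_sigma, h.1, h.2]
  rw [form, formL_apply, weakDeriv_embed, weakDeriv_embed, h1, h1, h2]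
  simp [inner_lam]

theorem assocOp_iff (β : ℝ → ℝ) (U F : H) :
    AssocOp (fun _ => 1) Real.sign Real.sign (fun _ => 0) β U F ↔
      ∃ v, embed v = U ∧ ∀ w, formL β v w = ⟪F, embed w⟫_ℝ := by
  rw [AssocOp, formDomain_eq_range]
  constructor
  · rintro ⟨⟨v, rfl⟩, h⟩
    exact ⟨v, rfl, fun w => by rw [← form_embed, h _ ⟨w, rfl⟩]⟩
  · rintro ⟨v, rfl, h⟩
    refine ⟨⟨v, rfl⟩, ?_⟩
    rintro _ ⟨w, rfl⟩
    rw [form_embed, h w]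

/-- Write u for the interior part and g for the boundary part. In 5/2, the share 2‖u‖² completes the
square (‖u'‖ - 2‖u‖)²/2 that absorbs the two sgn terms. The boundary term dominates |u(-1)|²/2
because u(-1) is one of the values of g. The operator norm absorbs β, of either sign. -/
theorem formL_coercive (β : ℝ → ℝ) (v : SobolevParam) :
    1 / 2 * ‖v‖ ^ 2 ≤ formL β v v + (5 / 2 + ‖mulL2 (memLp_sigma ∞ β)‖) * ‖embed v‖ ^ 2 := by
  rw [WithLp.prod_norm_sq_eq_of_L2 v, WithLp.prod_norm_sq_eq_of_L2 (embed v), formL_apply,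
    real_inner_self_eq_norm_sq]
  set b := ‖mulL2 (memLp_sigma ∞ β)‖
  have hb : 0 ≤ b := norm_nonneg _
  have h1 : |⟪mulL2 memLp_sign (embed v).fst, v.snd⟫_ℝ| ≤ ‖(embed v).fst‖ * ‖v.snd‖ :=
    (abs_real_inner_le_norm _ _).trans
      (mul_le_mul_of_nonneg_right (norm_mulL2_sign_le _) (norm_nonneg _))
  have h2 : |⟪mulL2 memLp_sign v.snd, (embed v).fst⟫_ℝ| ≤ ‖v.snd‖ * ‖(embed v).fst‖ :=
    (abs_real_inner_le_norm _ _).trans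
      (mul_le_mul_of_nonneg_right (norm_mulL2_sign_le _) (norm_nonneg _))
  have h3 : |⟪mulL2 (memLp_sigma ∞ β) (embed v).snd, (embed v).snd⟫_ℝ|
      ≤ b * ‖(embed v).snd‖ * ‖(embed v).snd‖ :=
    (abs_real_inner_le_norm _ _).trans
      (mul_le_mul_of_nonneg_right (ContinuousLinearMap.le_opNorm _ _) (norm_nonneg _))
  have h4 : ‖v.fst‖ ^ 2 ≤ ‖(embed v).snd‖ ^ 2 := by
    have h := ae_sigma_iff.1 (embed_snd_ae v)
    rw [← real_inner_self_eq_norm_sq (embed v).snd, inner_sigma, h.1, h.2, rep_neg_one,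
      Real.norm_eq_abs, sq_abs]
    nlinarith [mul_self_nonneg (rep v 1)]
  have h5 := neg_le_of_abs_le h1
  have h6 := neg_le_of_abs_le h2
  have h7 := neg_le_of_abs_le h3
  have h8 : 0 ≤ b * ‖(embed v).fst‖ ^ 2 := by positivity
  nlinarith [sq_nonneg (‖v.snd‖ - 2 * ‖(embed v).fst‖), sq_nonneg ‖(embed v).fst‖]

theorem exists_wentzellRobinSemigroup (β : ℝ → ℝ) : ∃ T : ℝ≥0 → H →L[ℝ] H,
    IsWentzellRobinSemigroup (fun _ => 1) Real.sign Real.sign (fun _ => 0) β T := by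
  obtain ⟨T, h0, hadd, hlim, hgen⟩ := exists_semigroup_of_form embed denseRange_embed (formL β)
    (by norm_num) (formL_coercive β)
  refine ⟨T, ⟨h0, hadd, hlim⟩, fun U F => ?_⟩
  rw [assocOp_iff]
  exact hgen U F

end WentzellRobin

end

/-! ### Orbits of a C₀-semigroup and the sup-norm resolvent estimate -/

noncomputable section

namespace WentzellRobin

open scoped InnerProductSpace

section Orbit

variable {T : ℝ≥0 → H →L[ℝ] H}

/-- Otherwise the norms blow up along some sequence of times tending to 0, while every orbit
converges along it, against uniform boundedness. The negative statement concerns every semigroup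
with the given generator, so no norm bound is available beforehand. -/
theorem IsC0Semigroup.exists_norm_le (hT : IsC0Semigroup T) :
    ∃ δ : ℝ≥0, 0 < δ ∧ ∃ M : ℝ, 1 ≤ M ∧ ∀ t ≤ δ, ‖T t‖ ≤ M := by
  by_contra! hcon
  have h1 : ∀ n : ℕ, ∃ t : ℝ≥0, t ≤ 1 / ((n : ℝ≥0) + 1) ∧ (n : ℝ) + 1 < ‖T t‖ := fun n =>
    hcon (1 / ((n : ℝ≥0) + 1)) (by positivity) ((n : ℝ) + 1)
      (le_add_of_nonneg_left (Nat.cast_nonneg n))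
  choose t ht hbig using h1
  have ht0 : Tendsto t atTop (𝓝 0) := by
    rw [← NNReal.tendsto_coe]
    refine squeeze_zero (fun n => (t n).2) (fun n => ?_) tendsto_one_div_add_atTop_nhds_zero_nat
    exact_mod_cast ht n
  obtain ⟨C, hC⟩ := banach_steinhaus (g := fun n => T (t n)) fun x => by
    obtain ⟨C, hC⟩ := ((hT.tendsto_zero x).comp ht0).norm.bddAbove_range
    exact ⟨C, fun n => hC ⟨n, rfl⟩⟩
  obtain ⟨n, hn⟩ := exists_nat_gt C
  linarith [hC n, hbig n]

theorem IsC0Semigroup.exists_norm_le_of_le (hT : IsC0Semigroup T) (t₀ : ℝ≥0) :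
    ∃ M : ℝ, ∀ t ≤ t₀, ‖T t‖ ≤ M := by
  obtain ⟨δ, hδ, M, hM1, hM⟩ := hT.exists_norm_le
  have h : ∀ k : ℕ, ∀ t : ℝ≥0, t ≤ k * δ → ‖T t‖ ≤ M ^ (k + 1) := by
    intro k
    induction k with
    | zero =>
      intro t ht
      rw [zero_add, pow_one]
      exact hM t (ht.trans (by simp))
    | succ k ih =>
      intro t ht
      rcases le_total t δ with htδ | htδ
      · exact (hM t htδ).trans (le_self_pow₀ hM1 (by omega))
      · have h1 : t = δ + (t - δ) := (add_tsub_cancel_of_le htδ).symm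
        have h2 : t - δ ≤ k * δ := by
          rw [tsub_le_iff_right]
          refine ht.trans (le_of_eq ?_)
          push_cast
          ring
        rw [h1, hT.add]
        refine (ContinuousLinearMap.opNorm_comp_le _ _).trans ?_
        rw [pow_succ' M (k + 1)]
        exact mul_le_mul (hM δ le_rfl) (ih _ h2) (norm_nonneg _) (by linarith)
  obtain ⟨k, hk⟩ := exists_nat_gt (t₀ / δ)
  rw [div_lt_iff₀ hδ] at hk
  exact ⟨_, fun t ht => h k t (ht.trans hk.le)⟩

theorem IsC0Semigroup.continuous (hT : IsC0Semigroup T) (x : H) : Continuous fun t => T t x := by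
  rw [continuous_iff_continuousAt]
  intro t₀
  obtain ⟨M, hM⟩ := hT.exists_norm_le_of_le (t₀ + 1)
  rw [ContinuousAt, tendsto_iff_norm_sub_tendsto_zero]
  have hdist : Tendsto (fun t => nndist t t₀) (𝓝 t₀) (𝓝 0) := by
    have : Continuous fun t : ℝ≥0 => nndist t t₀ := by fun_prop
    simpa using this.tendsto t₀
  have hlim : Tendsto (fun t => M * ‖T (nndist t t₀) x - x‖) (𝓝 t₀) (𝓝 0) := by
    have h := (((hT.tendsto_zero x).comp hdist).sub_const x).norm.const_mul M
    simpa using h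
  refine squeeze_zero' (Eventually.of_forall fun _ => norm_nonneg _) ?_ hlim
  have hev : ∀ᶠ t in 𝓝 t₀, t < t₀ + 1 := gt_mem_nhds (lt_add_one t₀)
  filter_upwards [hev] with t ht
  have key : ∀ a b : ℝ≥0, a ≤ b → a ≤ t₀ + 1 → ‖T b x - T a x‖ ≤ M * ‖T (b - a) x - x‖ := by
    intro a b hab ha
    have h1 : T b x - T a x = T a (T (b - a) x - x) := by
      conv_lhs => rw [← add_tsub_cancel_of_le hab, hT.add]
      simp
    rw [h1]
    exact (ContinuousLinearMap.le_opNorm _ _).trans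
      (mul_le_mul_of_nonneg_right (hM a ha) (norm_nonneg _))
  have hnn : ∀ a b : ℝ≥0, a ≤ b → nndist b a = b - a := by
    intro a b hab
    rw [NNReal.nndist_eq, tsub_eq_zero_of_le hab]
    simp
  rcases le_total t t₀ with h | h
  · rw [norm_sub_rev, nndist_comm, hnn t t₀ h]
    exact key t t₀ h ht.le
  · rw [hnn t₀ t h]
    exact key t₀ t h (le_add_of_nonneg_right zero_le_one)

/-- By the semigroup law the difference quotient at t is T(t) applied to the one at 0. The right
derivative is all that the mean value inequality needs. -/
theorem IsC0Semigroup.hasDerivWithinAt (hT : IsC0Semigroup T) {U F : H} (h : Generator T U F)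
    {t : ℝ} (ht : 0 ≤ t) :
    HasDerivWithinAt (fun s : ℝ => T s.toNNReal U) (T t.toNNReal F) (Set.Ici t) t := by
  rw [hasDerivWithinAt_iff_tendsto_slope, Set.Ici_sdiff_left]
  have hmap : Tendsto (fun s : ℝ => (s - t).toNNReal) (𝓝[>] t) (𝓝[>] 0) := by
    refine tendsto_nhdsWithin_iff.2 ⟨?_, ?_⟩
    · have : Continuous fun s : ℝ => (s - t).toNNReal := by fun_prop
      exact (this.tendsto' t 0 (by simp)).mono_left nhdsWithin_le_nhds
    · filter_upwards [self_mem_nhdsWithin] with s hs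
      exact Real.toNNReal_pos.2 (sub_pos.2 hs)
  have h1 := ((T t.toNNReal).continuous.tendsto F).comp (Tendsto.comp h hmap)
  refine h1.congr' ?_
  filter_upwards [self_mem_nhdsWithin] with s hs
  have hs' : 0 ≤ s - t := (sub_pos.2 hs).le
  have h2 : T s.toNNReal U = T t.toNNReal (T (s - t).toNNReal U) := by
    have h3 : s.toNNReal = t.toNNReal + (s - t).toNNReal := by
      rw [← Real.toNNReal_add ht hs', add_sub_cancel]
    rw [h3, hT.add]
    rfl
  simp only [Function.comp_apply, slope, vsub_eq_sub, h2, map_smul, map_sub,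
    Real.coe_toNNReal _ hs']

/-- The resolvent of the generator of an `ω`-quasi-contractive semigroup on `L^∞` satisfies
`‖(l + A)⁻¹‖ ≤ (l - ω)⁻¹` on `L^∞`, tested against a functional `ℓ` of `L¹`-norm at most `m`. -/
theorem IsC0Semigroup.mul_abs_le_of_isLinftyContractive (hT : IsC0Semigroup T) {ω l : ℝ}
    (hω : IsLinftyContractive ω T) (hl : ω < l) {U F : H} (hgen : Generator T U (-F))
    {K M m : ℝ} (hK0 : 0 ≤ K) (hM0 : 0 ≤ M)
    (hK : linftyNorm (l • U + F) ≤ ENNReal.ofReal K) (hM : linftyNorm U ≤ ENNReal.ofReal M)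
    (ℓ : H →L[ℝ] ℝ)
    (hℓ : ∀ W C, 0 ≤ C → linftyNorm W ≤ ENNReal.ofReal C → |ℓ W| ≤ C * m) :
    (l - ω) * |ℓ U| ≤ K * m := by
  have hlω : 0 < l - ω := sub_pos.2 hl
  have hbound : ∀ {W : H} {C : ℝ}, 0 ≤ C → linftyNorm W ≤ ENNReal.ofReal C → ∀ t : ℝ, 0 ≤ t →
      |Real.exp (-l * t) * ℓ (T t.toNNReal W)| ≤ Real.exp (-(l - ω) * t) * (C * m) := by
    intro W C hC hW t ht
    have h1 := hℓ _ C hC ((hω t.toNNReal W (hW.trans_lt ENNReal.ofReal_lt_top)).trans hW)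
    rw [Real.coe_toNNReal _ ht, map_smul, smul_eq_mul] at h1
    have h2 : Real.exp (-l * t) = Real.exp (-(l - ω) * t) * Real.exp (-ω * t) := by
      rw [← Real.exp_add]
      congr 1
      ring
    rw [h2, mul_assoc, abs_mul, abs_of_pos (Real.exp_pos _)]
    exact mul_le_mul_of_nonneg_left h1 (Real.exp_pos _).le
  have hexp : ∀ (a t : ℝ), HasDerivAt (fun t : ℝ => Real.exp (-a * t)) (-a * Real.exp (-a * t)) t :=
    fun a t => by
      simpa [mul_comm] using ((hasDerivAt_id t).const_mul (-a)).exp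
  -- This replaces the Laplace transform formula for the resolvent: only a scalar function is
  -- differentiated, so no vector-valued integral is needed.
  have hd : ∀ t, 0 ≤ t → HasDerivWithinAt
      (fun t : ℝ => Real.exp (-l * t) * ℓ (T t.toNNReal U) - ℓ U)
      (-(Real.exp (-l * t) * ℓ (T t.toNNReal (l • U + F)))) (Set.Ici t) t := by
    intro t ht
    have h1 := ℓ.hasFDerivAt.comp_hasDerivWithinAt t (hT.hasDerivWithinAt hgen ht)
    have h2 := (((hexp l t).hasDerivWithinAt (s := Set.Ici t)).mul h1).sub_const (ℓ U)
    convert! h2 using 1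
    simp only [map_add, map_smul, map_neg, smul_eq_mul, Function.comp_apply]
    ring
  have hcont : Continuous fun t : ℝ => Real.exp (-l * t) * ℓ (T t.toNNReal U) - ℓ U := by
    have h1 : Continuous fun t : ℝ => ℓ (T t.toNNReal U) :=
      ℓ.continuous.comp ((hT.continuous U).comp continuous_real_toNNReal)
    exact ((by fun_prop : Continuous fun t : ℝ => Real.exp (-l * t)).mul h1).sub continuous_const
  -- The comparison function is the primitive, vanishing at 0, of the bound on the derivative.
  have hB : ∀ t : ℝ, HasDerivAt
      (fun t : ℝ => K * m / (l - ω) * (1 - Real.exp (-(l - ω) * t)))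
      (Real.exp (-(l - ω) * t) * (K * m)) t := by
    intro t
    convert! ((hexp (l - ω) t).const_sub 1).const_mul (K * m / (l - ω)) using 1
    field_simp
  have hKm : 0 ≤ K * m := (abs_nonneg _).trans (hℓ _ K hK0 hK)
  have hest : ∀ b : ℝ, 0 ≤ b →
      |ℓ U| ≤ K * m / (l - ω) + Real.exp (-(l - ω) * b) * (M * m) := by
    intro b hb
    have h1 := image_norm_le_of_norm_deriv_right_le_deriv_boundary (a := 0) (b := b)
      hcont.continuousOn (fun t ht => hd t ht.1) (by simp [hT.zero]) hB
      (fun t ht => by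
        rw [norm_neg]
        exact hbound hK0 hK t ht.1) ⟨hb, le_rfl⟩
    have h2 := hbound hM0 hM b hb
    have h3 : K * m / (l - ω) * (1 - Real.exp (-(l - ω) * b)) ≤ K * m / (l - ω) :=
      mul_le_of_le_one_right (by positivity) (by linarith [Real.exp_pos (-(l - ω) * b)])
    rw [Real.norm_eq_abs, abs_sub_comm] at h1
    have h4 := abs_sub_abs_le_abs_sub (ℓ U) (Real.exp (-l * b) * ℓ (T b.toNNReal U))
    linarith
  -- The bound on U serves only to make the term at time b vanish as b → ∞.
  have hlim : Tendsto (fun b : ℝ => K * m / (l - ω) + Real.exp (-(l - ω) * b) * (M * m)) atTop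
      (𝓝 (K * m / (l - ω))) := by
    have h1 : Tendsto (fun b : ℝ => Real.exp (-(l - ω) * b)) atTop (𝓝 0) := by
      refine Real.tendsto_exp_atBot.comp ?_
      exact tendsto_id.const_mul_atTop_of_neg (neg_lt_zero.2 hlω)
    simpa using (h1.mul_const (M * m)).const_add (K * m / (l - ω))
  have h := ge_of_tendsto hlim ((eventually_ge_atTop 0).mono hest)
  rwa [le_div_iff₀ hlω, mul_comm] at h

end Orbit

theorem linftyNorm_le {F : H} {C : ℝ} (h1 : ∀ᵐ x ∂lam, |F.fst x| ≤ C)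
    (h2 : ∀ᵐ z ∂sigma, |F.snd z| ≤ C) : linftyNorm F ≤ ENNReal.ofReal C := by
  rw [linftyNorm, eLpNorm_exponent_top, eLpNorm_exponent_top]
  exact max_le (eLpNormEssSup_le_of_ae_bound h1) (eLpNormEssSup_le_of_ae_bound h2)

theorem ae_abs_le_of_linftyNorm_le {F : H} {C : ℝ} (hC : 0 ≤ C)
    (h : linftyNorm F ≤ ENNReal.ofReal C) : ∀ᵐ x ∂lam, |F.fst x| ≤ C := by
  rw [linftyNorm, eLpNorm_exponent_top] at h
  filter_upwards [ae_le_eLpNormEssSup (f := F.fst) (μ := lam)] with x hx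
  have h1 := hx.trans ((le_max_left _ _).trans h)
  rwa [← ofReal_norm, ENNReal.ofReal_le_ofReal_iff hC] at h1

/-- The functional `F ↦ ∫_S F.fst`. -/
def setIntegralL {S : Set ℝ} (hS : MeasurableSet S) : H →L[ℝ] ℝ :=
  innerSL ℝ (indicatorConstLp 2 hS (measure_ne_top lam S) (1 : ℝ)) ∘L
    WithLp.fstL 2 ℝ (Lp ℝ 2 lam) (Lp ℝ 2 sigma)

theorem setIntegralL_apply {S : Set ℝ} (hS : MeasurableSet S) (F : H) :
    setIntegralL hS F = ∫ x in S, F.fst x ∂lam :=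
  L2.inner_indicatorConstLp_one hS (measure_ne_top lam S) F.fst

theorem abs_setIntegralL_le {S : Set ℝ} (hS : MeasurableSet S) (F : H) (C : ℝ) (hC : 0 ≤ C)
    (h : linftyNorm F ≤ ENNReal.ofReal C) : |setIntegralL hS F| ≤ C * lam.real S := by
  rw [setIntegralL_apply]
  have h1 : ∀ᵐ x ∂lam.restrict S, ‖F.fst x‖ ≤ C :=
    ae_restrict_of_ae (ae_abs_le_of_linftyNorm_le hC h)
  exact norm_setIntegral_le_of_norm_le_const_ae (measure_lt_top lam S) h1

end WentzellRobin

end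

/-! ### The kink function and the failure of quasi-contractivity -/

noncomputable section

namespace WentzellRobin

open scoped InnerProductSpace

/-- A function with a concave kink at `0`, where it attains its maximum `1`. -/
def kink (n x : ℝ) : ℝ := 1 - 1 / n + Real.exp (-n * |x|) / n

/-- The derivative of `kink` off `0`. -/
def kinkDeriv (n x : ℝ) : ℝ := -(Real.sign x * Real.exp (-n * |x|))

/-- The flux `u' + sgn(x) u` of `u = kink n`. -/
def flux (n x : ℝ) : ℝ := (1 - 1 / n) * (Real.exp (n * min x 0) - Real.exp (-n * max x 0))

/-- The derivative of `flux`. -/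
def fluxDeriv (n x : ℝ) : ℝ := (n - 1) * Real.exp (-n * |x|)

theorem continuous_kink (n : ℝ) : Continuous (kink n) := by
  unfold kink
  fun_prop

theorem continuous_flux (n : ℝ) : Continuous (flux n) := by
  unfold flux
  fun_prop

theorem continuous_fluxDeriv (n : ℝ) : Continuous (fluxDeriv n) := by
  unfold fluxDeriv
  fun_prop

theorem hasDerivAt_exp_mul (a x : ℝ) :
    HasDerivAt (fun y => Real.exp (a * y)) (a * Real.exp (a * x)) x := by
  simpa [mul_comm] using ((hasDerivAt_id x).const_mul a).exp

theorem hasDerivAt_kink {n : ℝ} (hn : n ≠ 0) {x : ℝ} (hx : x ≠ 0) :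
    HasDerivAt (kink n) (kinkDeriv n x) x := by
  rcases hx.lt_or_gt with hx | hx
  · have h := ((hasDerivAt_exp_mul n x).div_const n).const_add (1 - 1 / n)
    rw [mul_div_cancel_left₀ _ hn] at h
    have e : kinkDeriv n x = Real.exp (n * x) := by
      rw [kinkDeriv, Real.sign_of_neg hx, abs_of_neg hx]
      simp
    rw [e]
    refine h.congr_of_eventuallyEq ?_
    filter_upwards [Iio_mem_nhds hx] with y hy
    rw [kink, abs_of_neg hy]
    simp
  · have h := ((hasDerivAt_exp_mul (-n) x).div_const n).const_add (1 - 1 / n)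
    rw [neg_mul, neg_div, mul_div_cancel_left₀ _ hn] at h
    have e : kinkDeriv n x = -Real.exp (-n * x) := by
      rw [kinkDeriv, Real.sign_of_pos hx, abs_of_pos hx, one_mul]
    rw [e]
    refine h.congr_of_eventuallyEq ?_
    filter_upwards [Ioi_mem_nhds hx] with y hy
    rw [kink, abs_of_pos hy]

theorem hasDerivAt_flux {n : ℝ} (hn : n ≠ 0) {x : ℝ} (hx : x ≠ 0) :
    HasDerivAt (flux n) (fluxDeriv n x) x := by
  rcases hx.lt_or_gt with hx | hx
  · have h := ((hasDerivAt_exp_mul n x).sub_const 1).const_mul (1 - 1 / n)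
    have e : fluxDeriv n x = (1 - 1 / n) * (n * Real.exp (n * x)) := by
      rw [fluxDeriv, abs_of_neg hx, neg_mul_neg]
      field_simp
    rw [e]
    refine h.congr_of_eventuallyEq ?_
    filter_upwards [Iio_mem_nhds hx] with y hy
    rw [flux, min_eq_left (le_of_lt hy), max_eq_right (le_of_lt hy)]
    simp
  · have h := ((hasDerivAt_exp_mul (-n) x).const_sub 1).const_mul (1 - 1 / n)
    have e : fluxDeriv n x = (1 - 1 / n) * -(-n * Real.exp (-n * x)) := by
      rw [fluxDeriv, abs_of_pos hx]
      field_simp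
    rw [e]
    refine h.congr_of_eventuallyEq ?_
    filter_upwards [Ioi_mem_nhds hx] with y hy
    rw [flux, min_eq_right (le_of_lt hy), max_eq_left (le_of_lt hy)]
    simp

/-- At 0 the jump -2 of the derivative cancels the jump 2 of sgn(x)u, because u(0) = 1. The
right-hand side is thus continuous, which puts the kink in the operator domain. -/
theorem kinkDeriv_add (n x : ℝ) : kinkDeriv n x + Real.sign x * kink n x = flux n x := by
  rcases lt_trichotomy x 0 with hx | rfl | hx
  · rw [kinkDeriv, kink, flux, Real.sign_of_neg hx, abs_of_neg hx, min_eq_left hx.le,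
      max_eq_right hx.le, neg_mul_neg, mul_zero, Real.exp_zero]
    ring
  · simp [kinkDeriv, flux]
  · rw [kinkDeriv, kink, flux, Real.sign_of_pos hx, abs_of_pos hx, min_eq_right hx.le,
      max_eq_left hx.le, mul_zero, Real.exp_zero]
    ring

theorem sign_mul_kinkDeriv (n : ℝ) {x : ℝ} (hx : x ≠ 0) :
    Real.sign x * kinkDeriv n x = -Real.exp (-n * |x|) := by
  rcases hx.lt_or_gt with hx | hx
  · rw [kinkDeriv, Real.sign_of_neg hx]; ring
  · rw [kinkDeriv, Real.sign_of_pos hx]; ring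

theorem memLp_kinkDeriv {n : ℝ} (hn : 0 ≤ n) : MemLp (kinkDeriv n) 2 lam := by
  have hm : Measurable (kinkDeriv n) :=
    (measurable_sign.mul (by fun_prop : Measurable fun x : ℝ => Real.exp (-n * |x|))).neg
  refine MemLp.of_bound hm.aestronglyMeasurable 1 (Eventually.of_forall fun x => ?_)
  have h1 : Real.exp (-n * |x|) ≤ 1 := Real.exp_le_one_iff.2 (by
    rw [neg_mul, neg_nonpos]; positivity)
  rw [kinkDeriv, norm_neg, norm_mul, Real.norm_eq_abs, Real.norm_eq_abs,
    abs_of_pos (Real.exp_pos _)]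
  exact mul_le_one₀ (abs_sign_le x) (Real.exp_pos _).le h1

/-- The image of `kink n` under the operator. -/
def kinkImage (β : ℝ → ℝ) (n : ℝ) : H :=
  WithLp.toLp 2
    ((memLp_lam_of_continuous (by fun_prop : Continuous fun x : ℝ => -(n * Real.exp (-n * |x|)))
        2).toLp _,
      (memLp_sigma 2 fun z => flux n 1 + β z * kink n 1).toLp _)

theorem kinkImage_fst_ae (β : ℝ → ℝ) (n : ℝ) :
    (kinkImage β n).fst =ᵐ[lam] fun x => -(n * Real.exp (-n * |x|)) :=
  (memLp_lam_of_continuous (by fun_prop) 2).coeFn_toLp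

theorem kinkImage_snd_ae (β : ℝ → ℝ) (n : ℝ) :
    (kinkImage β n).snd =ᵐ[sigma] fun z => flux n 1 + β z * kink n 1 :=
  (memLp_sigma 2 _).coeFn_toLp

theorem kink_neg_one (n : ℝ) : kink n (-1) = kink n 1 := by simp [kink]

/-- By oddness the outward flux is the same at both ends, hence the single value `flux n 1` in
`kinkImage`. -/
theorem flux_neg_one (n : ℝ) : flux n (-1) = -flux n 1 := by
  simp [flux]
  ring

/-- `kink n` as an element of `H¹(Ω)`. -/
def kinkParam {n : ℝ} (hn : 0 ≤ n) : SobolevParam := ofDeriv (kink n) (memLp_kinkDeriv hn)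

theorem rep_kinkParam {n : ℝ} (hn : 0 < n) {x : ℝ} (hx : x ∈ Set.Icc (-1 : ℝ) 1) :
    rep (kinkParam hn.le) x = kink n x :=
  rep_ofDeriv _ (continuous_kink n) (fun _ h => hasDerivAt_kink hn.ne' h) hx

theorem embed_kinkParam_fst_ae {n : ℝ} (hn : 0 < n) :
    (embed (kinkParam hn.le)).fst =ᵐ[lam] kink n := by
  filter_upwards [embed_fst_ae (kinkParam hn.le), ae_lam_mem_Icc] with x h1 h2
  rw [h1, rep_kinkParam hn h2]

theorem embed_kinkParam_snd_ae {n : ℝ} (hn : 0 < n) :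
    (embed (kinkParam hn.le)).snd =ᵐ[sigma] fun _ => kink n 1 := by
  have h := ae_sigma_iff.1 (embed_snd_ae (kinkParam hn.le))
  refine ae_sigma_iff.2 ⟨?_, ?_⟩
  · rw [h.1, rep_kinkParam hn (by norm_num), kink_neg_one]
  · rw [h.2, rep_kinkParam hn (by norm_num)]

/-- The flux is itself in H¹, so its pairing with w' can be integrated by parts. This leaves the
boundary fluxes and -(n - 1)∫ e^{-n|x|} w; the term sgn(x)u' w contributes another -∫ e^{-n|x|} w,
for a total factor of -n. -/
theorem assocOp_kink (β : ℝ → ℝ) {n : ℝ} (hn : 0 < n) :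
    AssocOp (fun _ => 1) Real.sign Real.sign (fun _ => 0) β (embed (kinkParam hn.le))
      (kinkImage β n) := by
  rw [assocOp_iff]
  refine ⟨_, rfl, fun w => ?_⟩
  have hne : ∀ᵐ x ∂lam, x ≠ 0 := by simp [ae_iff]
  have hfD : MemLp (fluxDeriv n) 2 lam := memLp_lam_of_continuous (continuous_fluxDeriv n) 2
  have hrep : ∀ x ∈ Set.Icc (-1 : ℝ) 1, rep (ofDeriv (flux n) hfD) x = flux n x := fun x hx =>
    rep_ofDeriv hfD (continuous_flux n) (fun _ h => hasDerivAt_flux hn.ne' h) hx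
  have hsnd : (kinkParam hn.le).snd =ᵐ[lam] kinkDeriv n := ofDeriv_snd_ae _ _
  have e1 : ⟪(kinkParam hn.le).snd, w.snd⟫_ℝ
      + ⟪mulL2 memLp_sign (embed (kinkParam hn.le)).fst, w.snd⟫_ℝ
      = ∫ x, rep (ofDeriv (flux n) hfD) x * w.snd x ∂lam := by
    rw [← inner_add_left, inner_lam]
    refine integral_congr_ae ?_
    filter_upwards [Lp.coeFn_add (kinkParam hn.le).snd
      (mulL2 memLp_sign (embed (kinkParam hn.le)).fst), hsnd,
      coeFn_mulL2 memLp_sign (embed (kinkParam hn.le)).fst, embed_kinkParam_fst_ae hn,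
      ae_lam_mem_Icc] with x h1 h2 h3 h4 h5
    rw [h1, Pi.add_apply, h2, h3, h4, kinkDeriv_add, hrep x h5]
  have e2 : ∫ x, (ofDeriv (flux n) hfD).snd x * rep w x ∂lam
      = (n - 1) * ∫ x, Real.exp (-n * |x|) * rep w x ∂lam := by
    rw [← integral_const_mul]
    refine integral_congr_ae ?_
    filter_upwards [ofDeriv_snd_ae (flux n) hfD] with x h1
    rw [h1, fluxDeriv, mul_assoc]
  have e3 : ⟪mulL2 memLp_sign (kinkParam hn.le).snd, (embed w).fst⟫_ℝ
      = -∫ x, Real.exp (-n * |x|) * rep w x ∂lam := by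
    rw [inner_lam, ← integral_neg]
    refine integral_congr_ae ?_
    filter_upwards [hsnd, coeFn_mulL2 memLp_sign (kinkParam hn.le).snd, embed_fst_ae w, hne]
      with x h1 h2 h3 h4
    rw [h2, h1, h3, sign_mul_kinkDeriv n h4, neg_mul]
  have e4 : ∫ x, (kinkImage β n).fst x * rep w x ∂lam
      = -n * ∫ x, Real.exp (-n * |x|) * rep w x ∂lam := by
    rw [← integral_const_mul]
    refine integral_congr_ae ?_
    filter_upwards [kinkImage_fst_ae β n] with x h1
    rw [h1]
    ring
  have m := ae_sigma_iff.1 (coeFn_mulL2 (memLp_sigma ∞ β) (embed (kinkParam hn.le)).snd)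
  have k := ae_sigma_iff.1 (embed_kinkParam_snd_ae hn)
  have r := ae_sigma_iff.1 (embed_snd_ae w)
  have i := ae_sigma_iff.1 (kinkImage_snd_ae β n)
  beta_reduce at m k i
  rw [formL_apply, e1, e3, integral_mul_rep, e2, hrep 1 (by norm_num), hrep (-1) (by norm_num),
    flux_neg_one, inner_sigma, m.1, m.2, k.1, k.2, r.1, r.2, inner_embed, e4, i.1, i.2]
  ring

theorem kink_nonneg {n : ℝ} (hn : 1 ≤ n) (x : ℝ) : 0 ≤ kink n x := by
  have h1 : 1 / n ≤ 1 := (div_le_one (by linarith)).2 hn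
  have h2 : 0 ≤ Real.exp (-n * |x|) / n := by positivity
  rw [kink]
  linarith

theorem kink_le_one {n : ℝ} (hn : 0 < n) (x : ℝ) : kink n x ≤ 1 := by
  have h1 : Real.exp (-n * |x|) ≤ 1 := Real.exp_le_one_iff.2 (by
    rw [neg_mul, neg_nonpos]; positivity)
  have h2 : Real.exp (-n * |x|) / n ≤ 1 / n := by gcongr
  rw [kink]
  linarith

/-- From 1 + y ≤ e^y: however sharp the kink, its slope is at most 1, so the function stays near 1
close to 0. -/
theorem one_sub_abs_le_kink {n : ℝ} (hn : 0 < n) (x : ℝ) : 1 - |x| ≤ kink n x := by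
  have h1 := Real.add_one_le_exp (-n * |x|)
  have h2 : (-n * |x| + 1) / n ≤ Real.exp (-n * |x|) / n := by gcongr
  have h3 : (-n * |x| + 1) / n = 1 / n - |x| := by field_simp; ring
  rw [kink]
  linarith

theorem linftyNorm_embed_kinkParam_le {n : ℝ} (hn : 1 ≤ n) :
    linftyNorm (embed (kinkParam (zero_le_one.trans hn))) ≤ ENNReal.ofReal 1 := by
  have hn0 : 0 < n := by linarith
  have h : ∀ x, |kink n x| ≤ 1 := fun x => by
    rw [abs_of_nonneg (kink_nonneg hn x)]
    exact kink_le_one hn0 x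
  refine linftyNorm_le ?_ ?_
  · filter_upwards [embed_kinkParam_fst_ae hn0] with x hx
    rw [hx]
    exact h x
  · filter_upwards [embed_kinkParam_snd_ae hn0] with x hx
    rw [hx]
    exact h 1

/-- The value l = n² is chosen so that the exponentials cancel in the interior and leave n² - n. At
the boundary n e^{-n} and the flux are each at most 1, which accounts for the 2. -/
theorem linftyNorm_resolvent_kink_le (β : ℝ → ℝ) {n : ℝ} (hn : 1 ≤ n) :
    linftyNorm (n ^ 2 • embed (kinkParam (zero_le_one.trans hn)) + kinkImage β n)
      ≤ ENNReal.ofReal (n ^ 2 - n + 2 + (|β (-1)| + |β 1|)) := by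
  have hn0 : 0 < n := by linarith
  set U := embed (kinkParam (zero_le_one.trans hn)) with hU
  have hnn : 0 ≤ n ^ 2 - n := by nlinarith
  refine linftyNorm_le ?_ ?_
  · have h := Lp.coeFn_add (n ^ 2 • U.fst) (kinkImage β n).fst
    filter_upwards [h, Lp.coeFn_smul (n ^ 2) U.fst, embed_kinkParam_fst_ae hn0,
      kinkImage_fst_ae β n] with x h1 h2 h3 h4
    have h5 : (n ^ 2 • U + kinkImage β n).fst x = n ^ 2 - n := by
      rw [WithLp.add_fst, WithLp.smul_fst, h1, Pi.add_apply, h2, Pi.smul_apply, h3, h4, kink,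
        smul_eq_mul]
      field_simp
      ring
    rw [h5, abs_of_nonneg hnn]
    linarith [abs_nonneg (β (-1)), abs_nonneg (β 1)]
  · have h := Lp.coeFn_add (n ^ 2 • U.snd) (kinkImage β n).snd
    filter_upwards [h, Lp.coeFn_smul (n ^ 2) U.snd, embed_kinkParam_snd_ae hn0,
      kinkImage_snd_ae β n, norm_le_of_ae_sigma β] with z h1 h2 h3 h4 hβ
    have h5 : (n ^ 2 • U + kinkImage β n).snd z
        = n ^ 2 * kink n 1 + (flux n 1 + β z * kink n 1) := by
      rw [WithLp.add_snd, WithLp.smul_snd, h1, Pi.add_apply, h2, Pi.smul_apply, h3, h4,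
        smul_eq_mul]
    have hk0 := kink_nonneg hn 1
    have hk1 := kink_le_one hn0 1
    have hE0 := Real.exp_pos (-n)
    have hE1 : n * Real.exp (-n) ≤ 1 := by
      have h6 : n ≤ Real.exp n := by linarith [Real.add_one_le_exp n]
      rw [Real.exp_neg, ← div_eq_mul_inv]
      exact (div_le_one (Real.exp_pos _)).2 h6
    have e1 : n ^ 2 * kink n 1 = n ^ 2 - n + n * Real.exp (-n) := by
      rw [kink, abs_one, mul_one]
      field_simp
    have e2 : flux n 1 = (1 - 1 / n) * (1 - Real.exp (-n)) := by
      simp [flux]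
    have hi : 1 / n ≤ 1 := (div_le_one (by linarith)).2 hn
    have hi0 : 0 < 1 / n := by positivity
    have hE2 : Real.exp (-n) ≤ 1 := Real.exp_le_one_iff.2 (by linarith)
    have hf0 : 0 ≤ flux n 1 := by
      rw [e2]
      exact mul_nonneg (by linarith) (by linarith)
    have hf1 : flux n 1 ≤ 1 := by
      rw [e2]
      exact mul_le_one₀ (by linarith) (by linarith) (by linarith)
    have hβ' : |β z * kink n 1| ≤ |β (-1)| + |β 1| := by
      rw [abs_mul, abs_of_nonneg hk0]
      exact (mul_le_of_le_one_right (abs_nonneg _) hk1).trans hβ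
    rw [h5, e1]
    have hpos : 0 ≤ n * Real.exp (-n) := by positivity
    rw [abs_le] at hβ' ⊢
    constructor <;> linarith [hβ'.1, hβ'.2]

theorem not_isLinftyContractive (β : ℝ → ℝ) {T : ℝ≥0 → H →L[ℝ] H}
    (hT : IsWentzellRobinSemigroup (fun _ => 1) Real.sign Real.sign (fun _ => 0) β T) (ω : ℝ) :
    ¬ IsLinftyContractive ω T := by
  intro hω
  set b := |β (-1)| + |β 1| with hb
  have hb0 : 0 ≤ b := by positivity
  -- Averaging near 0 will cost 1, so the resolvent estimate gives n² - ω - 1 ≤ n² - n + 2 + b, i.e.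
  -- n ≤ ω + b + 3.
  obtain ⟨n, hnb⟩ : ∃ n : ℝ, n = |ω| + b + 4 := ⟨_, rfl⟩
  have hωn : ω ≤ |ω| := le_abs_self ω
  have hω0 : 0 ≤ |ω| := abs_nonneg ω
  have hn : 1 ≤ n := by linarith
  have hn0 : 0 < n := by linarith
  have hl : ω < n ^ 2 := by nlinarith
  have hgen : Generator T (embed (kinkParam hn0.le)) (-kinkImage β n) := by
    rw [hT.2, neg_neg]
    exact assocOp_kink β hn0
  -- Elements of L² have no value at 0, so the maximum is probed by integrating over (-δ, δ), where
  -- u ≥ 1 - δ. This δ keeps the loss (n² - ω)δ at most 1.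
  obtain ⟨δ, hδ⟩ : ∃ δ : ℝ, δ = 1 / (n ^ 2 + |ω| + 1) := ⟨_, rfl⟩
  have hden : 0 < n ^ 2 + |ω| + 1 := by positivity
  have hδ0 : 0 < δ := by rw [hδ]; positivity
  have hδ1 : δ ≤ 1 := by
    rw [hδ, div_le_one hden]
    nlinarith
  have hδ2 : (n ^ 2 - ω) * δ ≤ 1 := by
    rw [hδ, mul_one_div, div_le_one hden]
    linarith [neg_abs_le ω]
  have hS : MeasurableSet (Set.Ioo (-δ) δ) := measurableSet_Ioo
  have hm : 0 < lam.real (Set.Ioo (-δ) δ) := by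
    rw [lam_eq, measureReal_restrict_apply hS,
      Set.inter_eq_left.2 (Set.Ioo_subset_Ioo (by linarith) hδ1), Real.volume_real_Ioo]
    exact lt_max_of_lt_left (by linarith)
  have hmain := hT.1.mul_abs_le_of_isLinftyContractive hω hl hgen
    (K := n ^ 2 - n + 2 + b) (by nlinarith) zero_le_one
    (linftyNorm_resolvent_kink_le β hn) (linftyNorm_embed_kinkParam_le hn)
    (setIntegralL hS) (abs_setIntegralL_le hS)
  have hlow : (1 - δ) * lam.real (Set.Ioo (-δ) δ) ≤ setIntegralL hS (embed (kinkParam hn0.le)) := by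
    rw [setIntegralL_apply]
    have h1 : ∫ _ in Set.Ioo (-δ) δ, (1 - δ) ∂lam = (1 - δ) * lam.real (Set.Ioo (-δ) δ) := by
      rw [setIntegral_const, smul_eq_mul, mul_comm]
    rw [← h1]
    refine setIntegral_mono_ae_restrict (integrable_const _).integrableOn
      (integrable_Lp _).integrableOn ?_
    filter_upwards [ae_restrict_of_ae (embed_kinkParam_fst_ae hn0), ae_restrict_mem hS]
      with x h2 h3
    rw [h2]
    have h4 : |x| < δ := abs_lt.2 h3
    linarith [one_sub_abs_le_kink hn0 x]
  have h1 := hlow.trans (le_abs_self _)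
  have h2 := (mul_le_mul_of_nonneg_left h1 (sub_pos.2 hl).le).trans hmain
  rw [← mul_assoc] at h2
  have h3 := le_of_mul_le_mul_right h2 hm
  nlinarith

end WentzellRobin

end

theorem mainTheorem8 (β : ℝ → ℝ) :
    (∃ T : ℝ≥0 → WentzellRobin.H →L[ℝ] WentzellRobin.H,
      WentzellRobin.IsWentzellRobinSemigroup
        (fun _ => 1) Real.sign Real.sign (fun _ => 0) β T) ∧
    ∀ T : ℝ≥0 → WentzellRobin.H →L[ℝ] WentzellRobin.H,
      WentzellRobin.IsWentzellRobinSemigroup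
        (fun _ => 1) Real.sign Real.sign (fun _ => 0) β T →
      ¬ ∃ ω : ℝ, WentzellRobin.IsLinftyContractive ω T :=
  ⟨WentzellRobin.exists_wentzellRobinSemigroup β, fun _ hT ⟨ω, hω⟩ =>
    WentzellRobin.not_isLinftyContractive β hT ω hω⟩
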